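/- **Definitions.** Let $\mathcal D$ be a connected projection of a link to the plane, with its faces coloured black and white so that no two faces of the same colour border the same arc. Its black graph $B(\mathcal D)$ is the plane graph whose vertices are the black faces and whose edges are the crossings, each joining the two black faces (or black corners) that meet there. An edge has height $0$ if the edge, the lower arc of the crossing and the upper arc of the crossing occur in this order clockwise, and height $1$ otherwise. Choose a vertex of $B(\mathcal D)$ as a base point, and let $F$ be the field of rational functions over $\mathbb F_2$ in variables corresponding to the vertices other than the base point and to the bounded faces of $B(\mathcal D)$. For $i\in\frac12\mathbb Z$ let $\mathcal C_0(\mathcal D)_i$ be the $F$-vector space with basis the spanning trees $T$ of $B(\mathcal D)$ for which the number of edges of height $1$ in $T$ plus the number of edges of height $0$ not in $T$ equals $2i$. The differential $\Psi:\mathcal C_0(\mathcal D)_i\to\mathcal C_0(\mathcal D)_{i+1}$ has a possibly non-zero coefficient from $T$ to $T'$ only if $T'=(T\smallsetminus\{e\})\cup\{f\}$ with $e\in T$ of height $0$ and $f\notin T$ of height $1$; this coefficient is $$\frac1{1+\alpha}+\frac1{1+\beta}.$$ Here, with $c$ the cycle in $T\cup\{f\}$, $\alpha$ is the product of the variables of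 all faces enclosed by $c$ if $e$, $f$ and the base point (attached to $c$ through $T$) occur counterclockwise on $c$, and the product of their inverses otherwise; $\beta$ is the product of the variables of all vertices in the component of $T\smallsetminus\{e\}$ that does not contain the base point. The unshifted Baldwin–Ozsváth–Szabó cohomology $H^i(\mathcal C_0(\mathcal D))$ is the cohomology of this complex in degree $i$. Let $B_{(3,6)}$ be the following plane graph: a circle subdivided into $9$ edges of height $0$, and one central vertex inside the circle joined by two edges of height $1$ (spokes) to two vertices of the circle which divide it into arcs of $3$ and $6$ edges. Let $\mathcal D_{(3,6)}$ be a link projection with black graph $B_{(3,6)}$. **Statement.** For every choice of the base point, $$\operatorname{rank}_F H^i(\mathcal C_0(\mathcal D_{(3,6)}))=\begin{cases}1 & \text{for } i=1,2,\\ 0 & \text{for all other } i.\end{cases}$$ -/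

import Mathlib

/-! ### Plane graphs and their Baldwin-Ozsvath-Szabo complex -/

/-- The combinatorial data of a finite connected plane graph (loops and multiple edges allowed)
whose edges carry heights: vertices `V`, edges `E`, faces `F`. Every edge `e` is given a reference
direction from `src e` to `tgt e`, and then has the face `left e` on its left and the face
`right e` on its right. `outer` is the unbounded face. `high e` means that `e` has height `1`;
otherwise it has height `0`. -/
structure PlaneGraph where
  V : Type
  E : Type
  F : Type
  [fintypeV : Fintype V]
  [fintypeE : Fintype E]
  [fintypeF : Fintype F]
  src : E → V
  tgt : E → V
  left : E → F
  right : E → F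
  outer : F
  high : E → Prop

namespace PlaneGraph

attribute [instance] PlaneGraph.fintypeV PlaneGraph.fintypeE PlaneGraph.fintypeF

open scoped Classical

noncomputable section

variable (G : PlaneGraph)

/-- Two vertices are joined by a path whose edges lie in `S`. -/
def Joined (S : Set G.E) : G.V → G.V → Prop :=
  Relation.EqvGen fun u v => ∃ e ∈ S, G.src e = u ∧ G.tgt e = v

/-- Two faces are joined by a path in the plane that avoids the vertices and crosses only edges
in `S`. -/
def FaceJoined (S : Set G.E) : G.F → G.F → Prop :=
  Relation.EqvGen fun φ ψ => ∃ e ∈ S, G.left e = φ ∧ G.right e = ψ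

/-- `T` is (the edge set of) a spanning tree: it connects all vertices, and it has one edge less
than there are vertices. -/
def IsSpanningTree (T : Finset G.E) : Prop :=
  (∀ u v, G.Joined (T : Set G.E) u v) ∧ T.card + 1 = Fintype.card G.V

/-- The number of edges of height `1` in `T` plus the number of edges of height `0` not in `T`. -/
def totalHeight (T : Finset G.E) : ℕ :=
  (Finset.univ.filter fun e => G.high e ∧ e ∈ T).card +
    (Finset.univ.filter fun e => ¬ G.high e ∧ e ∉ T).card

/-- The generators in degree `i`: the spanning trees of total height `2 i`. Degrees may be
half-integers. -/
def Tree (i : ℚ) : Type :=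
  {T : Finset G.E // G.IsSpanningTree T ∧ (G.totalHeight T : ℚ) = 2 * i}

instance (i : ℚ) : Fintype (G.Tree i) := by
  unfold Tree
  infer_instance

/-- The variables: one for each vertex other than the base point, one for each bounded face. -/
abbrev Var (base : G.V) : Type := {v : G.V // v ≠ base} ⊕ {φ : G.F // φ ≠ G.outer}

/-- The field of rational functions over the field with two elements in these variables. -/
abbrev FunField (base : G.V) : Type :=
  FractionRing (MvPolynomial (G.Var base) (ZMod 2))

/-- A variable as an element of the field. -/
def var (base : G.V) (x : G.Var base) : G.FunField base :=
  algebraMap (MvPolynomial (G.Var base) (ZMod 2)) (G.FunField base) (MvPolynomial.X x)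

/-- The cycle of `T ∪ {f}`, for a spanning tree `T` and an edge `f` outside it: it consists of
those edges whose removal from `T ∪ {f}` leaves a spanning tree. -/
def cycle (T : Finset G.E) (f : G.E) : Finset G.E :=
  (insert f T).filter fun g => G.IsSpanningTree ((insert f T).erase g)

/-- The face `φ` is enclosed by the cycle with edge set `c`: one cannot leave it for the unbounded
face without crossing `c`. -/
def Enclosed (c : Finset G.E) (φ : G.F) : Prop :=
  ¬ G.FaceJoined {g | g ∉ c} φ G.outer

/-- Let `T` be a spanning tree, `e` an edge of `T` and `f` an edge outside `T` such that
`T \ {e} ∪ {f}` is a spanning tree, and let `c` be the cycle of `T ∪ {f}`; it contains `e` and `f`.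
The base point is attached to `c` through the tree. `Counterclockwise base T e f` says that
`e`, `f` and the base point occur in this order counterclockwise on `c`.

The counterclockwise direction of `f` on `c` is the one that has an enclosed face on its left.
Removing `e` and `f` cuts `c` into two arcs, which lie in the two different components of
`T \ {e}`; the order is `e`, `f`, base point exactly if the arc that begins at the
counterclockwise end of `f` is the one to which the base point is attached. -/
def Counterclockwise (base : G.V) (T : Finset G.E) (e f : G.E) : Prop :=
  (G.Enclosed (G.cycle T f) (G.left f) ∧ G.Joined {g | g ∈ T ∧ g ≠ e} (G.tgt f) base) ∨
    (G.Enclosed (G.cycle T f) (G.right f) ∧ G.Joined {g | g ∈ T ∧ g ≠ e} (G.src f) base)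

/-- The product of the variables of the faces enclosed by the cycle of `T ∪ {f}`, or of their
inverses, depending on the orientation. -/
def alpha (base : G.V) (T : Finset G.E) (e f : G.E) : G.FunField base :=
  if G.Counterclockwise base T e f then
    ∏ φ : {φ : G.F // φ ≠ G.outer},
      if G.Enclosed (G.cycle T f) φ.1 then G.var base (Sum.inr φ) else 1
  else
    ∏ φ : {φ : G.F // φ ≠ G.outer},
      if G.Enclosed (G.cycle T f) φ.1 then (G.var base (Sum.inr φ))⁻¹ else 1

/-- The product of the variables of the vertices in the component of `T \ {e}` that does not
contain the base point. -/
def beta (base : G.V) (T : Finset G.E) (e : G.E) : G.FunField base :=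
  ∏ v : {v : G.V // v ≠ base},
    if G.Joined {g | g ∈ T ∧ g ≠ e} v.1 base then 1 else G.var base (Sum.inl v)

/-- The coefficient of the differential from the spanning tree `T` to the spanning tree `T'`.
It vanishes unless `T'` arises from `T` by removing an edge `e` of height `0` and adding an edge
`f` of height `1`; at most one pair `(e, f)` contributes to the sum. -/
def coeff (base : G.V) (T T' : Finset G.E) : G.FunField base :=
  ∑ e : G.E, ∑ f : G.E,
    if e ∈ T ∧ f ∉ T ∧ ¬ G.high e ∧ G.high f ∧ T' = insert f (T.erase e) then
      1 / (1 + G.alpha base T e f) + 1 / (1 + G.beta base T e)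
    else 0

/-- The unshifted complex in degree `i`: the vector space with basis the spanning trees of total
height `2 i`. -/
abbrev Cochain (base : G.V) (i : ℚ) : Type := G.Tree i → G.FunField base

/-- The component from degree `i` to degree `j` of the differential (it is zero for
`j ≠ i + 1`). -/
def differential (base : G.V) (i j : ℚ) :
    G.Cochain base i →ₗ[G.FunField base] G.Cochain base j :=
  Matrix.mulVecLin (Matrix.of fun (T' : G.Tree j) (T : G.Tree i) => G.coeff base T.1 T'.1)

/-- The unshifted cohomology in degree `i`: the kernel of the differential out of degree `i`
modulo the image of the differential into degree `i`. -/
abbrev Cohomology (base : G.V) (i : ℚ) : Type :=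
  LinearMap.ker (G.differential base i (i + 1)) ⧸
    (LinearMap.range (G.differential base (i - 1) i)).submoduleOf
      (LinearMap.ker (G.differential base i (i + 1)))

end

/-- An isomorphism of plane graphs with heights. It may reverse the (immaterial) reference
direction of an edge, which exchanges source and target as well as left and right. -/
structure Iso (G H : PlaneGraph) where
  onV : G.V ≃ H.V
  onE : G.E ≃ H.E
  onF : G.F ≃ H.F
  incidence : ∀ e,
    (H.src (onE e) = onV (G.src e) ∧ H.tgt (onE e) = onV (G.tgt e) ∧
      H.left (onE e) = onF (G.left e) ∧ H.right (onE e) = onF (G.right e)) ∨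
    (H.src (onE e) = onV (G.tgt e) ∧ H.tgt (onE e) = onV (G.src e) ∧
      H.left (onE e) = onF (G.right e) ∧ H.right (onE e) = onF (G.left e))
  outer : H.outer = onF G.outer
  high : ∀ e, H.high (onE e) ↔ G.high e

end PlaneGraph

/-! ### Link projections and their black graphs -/

/-- A connected projection of a link to the plane, with at least one crossing, up to isotopy of
the sphere. The four half-arcs at a crossing `c` are the pairs `(c, i)`, numbered
counterclockwise; `(c, 0)` and `(c, 2)` form the lower arc of the crossing, `(c, 1)` and `(c, 3)`
the upper arc. `glue` tells which half-arcs form the arcs of the projection.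

The pair `(c, i)` also stands for the corner at `c` between the half-arcs `(c, i)` and
`(c, i + 1)`. Walk away from `c` along the half-arc `(c, i)`, with the corner `(c, i)` on the left,
and arrive along `(c', i')`: then the corner on the left is `(c', i' - 1)`. So the faces of the
projection are the classes of corners under the relation generated by
`(c, i) ~ (c', i' - 1)`, where `glue (c, i) = (c', i')`. -/
structure LinkProjection where
  C : Type
  [fintypeC : Fintype C]
  glue : C × ZMod 4 → C × ZMod 4
  glue_glue : ∀ x, glue (glue x) = x
  glue_ne : ∀ x, glue x ≠ x
  /-- The projection is connected. -/
  connected : ∀ x y : C × ZMod 4,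
    Relation.EqvGen (fun a b => b = glue a ∨ b = (a.1, a.2 + 1)) x y
  /-- Euler's formula for the sphere; there are twice as many arcs as crossings. -/
  planar : Nat.card (Quot fun a b : C × ZMod 4 => b = ((glue a).1, (glue a).2 - 1))
    = Nat.card C + 2

namespace LinkProjection

attribute [instance] LinkProjection.fintypeC

/-- The faces of a projection. -/
def Region (D : LinkProjection) : Type :=
  Quot fun a b : D.C × ZMod 4 => b = ((D.glue a).1, (D.glue a).2 - 1)

/-- The face that contains a corner. -/
def region (D : LinkProjection) (x : D.C × ZMod 4) : D.Region := Quot.mk _ x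

instance (D : LinkProjection) : Finite D.Region :=
  Finite.of_surjective D.region Quot.mk_surjective

/-- A colouring of the faces black and white such that faces on the two sides of an arc have
different colours (the corners `(c, i)` and `(c, i + 1)` are the two sides of the half-arc
`(c, i + 1)`), together with the white face that contains the unbounded face of the black graph. -/
structure Colouring (D : LinkProjection) where
  black : Set D.Region
  alternating : ∀ c i, D.region (c, i + 1) ∈ black ↔ D.region (c, i) ∉ black
  outer : D.Region
  outer_white : outer ∉ black

namespace Colouring

open scoped Classical

noncomputable section

variable {D : LinkProjection} (S : D.Colouring)

/-- The number of the first black corner at a crossing. It is also the height of the crossing: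
if the corners `(c, 0)` and `(c, 2)` are black, then the edge of the black graph through `c`, the
lower arc and the upper arc occur in this order clockwise (height `0`); if the corners `(c, 1)` and
`(c, 3)` are black, they occur in this order counterclockwise (height `1`). -/
def first (c : D.C) : ZMod 4 := if D.region (c, 0) ∈ S.black then 0 else 1

theorem first_black (c : D.C) : D.region (c, S.first c) ∈ S.black := by
  unfold first
  split_ifs with h
  · exact h
  · simpa using (S.alternating c 0).2 h

theorem second_white (c : D.C) : D.region (c, S.first c + 1) ∉ S.black := fun h =>
  (S.alternating c _).1 h (S.first_black c)

theorem third_black (c : D.C) : D.region (c, S.first c + 2) ∈ S.black := by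
  have h := (S.alternating c (S.first c + 1)).2 (S.second_white c)
  rwa [add_assoc, one_add_one_eq_two] at h

theorem fourth_white (c : D.C) : D.region (c, S.first c + 3) ∉ S.black := by
  intro h
  have h2 := S.alternating c (S.first c + 2)
  rw [add_assoc, two_add_one_eq_three] at h2
  exact h2.1 h (S.third_black c)

/-- The black graph. Its vertices are the black faces, its edges are the crossings, and its faces
are the white faces. The edge through the crossing `c` runs from the corner number `first c` to
the opposite corner. -/
def blackGraph : PlaneGraph :=
  haveI : Fintype D.Region := Fintype.ofFinite _
  { V := {r : D.Region // r ∈ S.black}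
    E := D.C
    F := {r : D.Region // r ∉ S.black}
    src := fun c => ⟨D.region (c, S.first c), S.first_black c⟩
    tgt := fun c => ⟨D.region (c, S.first c + 2), S.third_black c⟩
    left := fun c => ⟨D.region (c, S.first c + 3), S.fourth_white c⟩
    right := fun c => ⟨D.region (c, S.first c + 1), S.second_white c⟩
    outer := ⟨S.outer, S.outer_white⟩
    high := fun c => D.region (c, 0) ∉ S.black }

end

end Colouring

end LinkProjection

/-! ### The wheel graphs -/

/-- The black graph of the projection with parameters `(n 0, …, n (k - 1))`: a circle, subdivided
into `n 0 + ⋯ + n (k - 1)` rim edges of height `0`, with `k` spokes of height `1` that run from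
a central vertex (`none`) to the circle. In counterclockwise order around the circle one meets the
end of the spoke `0`, then `n 0` rim edges, the end of the spoke `1`, then `n 1` rim edges, and so
on. The rim vertices are numbered counterclockwise, starting with the end of the spoke `0`; two
consecutive spokes `i`, `i + 1` with `n i = 0` are parallel.

The face `some i` is the sector between the spokes `i` and `i + 1`; `none` is the unbounded face.
Spokes are directed outwards and rim edges counterclockwise. -/
def wheelGraph {k : ℕ} [NeZero k] (n : Fin k → ℕ) [NeZero (∑ i, n i)] : PlaneGraph where
  V := Option (Fin (∑ i, n i))
  E := Fin k ⊕ (Σ i : Fin k, Fin (n i))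
  F := Option (Fin k)
  src := Sum.elim (fun _ => none) (fun a => some (finSigmaFinEquiv a))
  tgt := Sum.elim (fun i => some (Fin.ofNat _ (∑ j ∈ Finset.Iio i, n j)))
    (fun a => some (finSigmaFinEquiv a + 1))
  left := Sum.elim (fun i => some i) (fun a => some a.1)
  right := Sum.elim (fun i => some (i - 1)) (fun _ => none)
  outer := none
  high := fun e => e.isLeft = true

instance neZeroThreeSix : NeZero (∑ i, ![3, 6] i) := ⟨by decide⟩

/-!
The wheel with two spokes and rim arcs of `3` and `6` edges has `36` spanning trees. A pair of edges
is the complement of a spanning tree exactly if it consists of a spoke and a rim edge, or of two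
rim edges from different arcs. So `18` trees have one spoke and lie in degree `1`, and `18` trees
have both spokes and lie in degree `2`; all other degrees vanish. The assertion is that the
differential from degree `1` to degree `2` has rank `17`, and it is proved by showing that its
kernel consists of the constant cochains.

Give the base point the weight that makes the product of the weights of all vertices equal to `1`.
In characteristic `2` one has `1 / (1 + z⁻¹) = 1 + 1 / (1 + z)`, so passing to the other side of the
base point changes both summands of a coefficient by `1`, and the coefficients become independent
of the base point (`coeff_pull`). A tree with both spokes omits a rim edge `a` of the first arc and
a rim edge `b` of the second. Without these two edges the rim consists of two segments; the weight
of the segment at the end of the first spoke is a product `s a * t b`, and that of the other one is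
`(h * (s a * t b))⁻¹`, where `h` is the weight of the hub. The row of the differential that belongs
to `(a, b)` has four entries, and after clearing denominators it says that a polynomial expression
of degree `2` in `s a` and of degree `2` in `t b` vanishes. As `s` takes three values, the relations
can be solved for the coefficients of `1` and `(s a) ^ 2`; comparing the two solutions gives a
polynomial of degree `4` in `t` which has the six zeros `t b`, hence is zero
(`eq_const_of_quadratic_relations`). This forces a closed cochain to be constant
(`eq_const_of_row_relations`). The weights are generic enough for this, because a nonempty product
of distinct variables is not `1` (`prod_var_ne_one`, `prod_weight_ne_one`).

The black graph is only isomorphic to the wheel, possibly with edges reversed, so the combinatorial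
predicates are computed in a model of the wheel (`wheel36`) and transported along the isomorphism.
-/

/-! ### Transport along isomorphisms of plane graphs -/

namespace PlaneGraph

open scoped Classical

namespace Iso

variable {G H K : PlaneGraph}

/-- The composite of two isomorphisms. -/
def trans (φ : G.Iso H) (ψ : H.Iso K) : G.Iso K where
  onV := φ.onV.trans ψ.onV
  onE := φ.onE.trans ψ.onE
  onF := φ.onF.trans ψ.onF
  incidence e := by
    rcases φ.incidence e with ⟨h1, h2, h3, h4⟩ | ⟨h1, h2, h3, h4⟩ <;>
      rcases ψ.incidence (φ.onE e) with ⟨k1, k2, k3, k4⟩ | ⟨k1, k2, k3, k4⟩ <;>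
      simp [h1, h2, h3, h4, k1, k2, k3, k4]
  outer := by simp [ψ.outer, φ.outer]
  high e := by simp [ψ.high, φ.high]

/-- The preimage in `G` of a set of edges of `H`. -/
noncomputable def pull (φ : G.Iso H) (T : Finset H.E) : Finset G.E :=
  T.map φ.onE.symm.toEmbedding

variable (φ : G.Iso H)

@[simp]
theorem mem_pull {T : Finset H.E} {e : G.E} : e ∈ φ.pull T ↔ φ.onE e ∈ T := by
  simp [pull]

theorem pull_injective : Function.Injective φ.pull := Finset.map_injective _

theorem pull_surjective : Function.Surjective φ.pull := fun T =>
  ⟨T.map φ.onE.toEmbedding, by ext e; simp⟩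

theorem card_pull (T : Finset H.E) : (φ.pull T).card = T.card := Finset.card_map _

theorem joined_iff (S : Set H.E) (u v : G.V) :
    G.Joined (φ.onE ⁻¹' S) u v ↔ H.Joined S (φ.onV u) (φ.onV v) := by
  constructor
  · intro h
    induction h with
    | rel x y h =>
      obtain ⟨e, he, rfl, rfl⟩ := h
      rcases φ.incidence e with h | h
      · exact .rel _ _ ⟨_, he, h.1, h.2.1⟩
      · exact .symm _ _ (.rel _ _ ⟨_, he, h.1, h.2.1⟩)
    | refl x => exact .refl _
    | symm x y _ ih => exact .symm _ _ ih
    | trans x y z _ _ h1 h2 => exact .trans _ _ _ h1 h2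
  · suffices ∀ a b, H.Joined S a b →
        G.Joined (φ.onE ⁻¹' S) (φ.onV.symm a) (φ.onV.symm b) by
      intro h
      simpa using this _ _ h
    intro a b h
    induction h with
    | rel x y h =>
      obtain ⟨e, he, rfl, rfl⟩ := h
      obtain ⟨e, rfl⟩ := φ.onE.surjective e
      rcases φ.incidence e with h | h <;> rw [h.1, h.2.1]
      · exact .rel _ _ ⟨e, he, by simp⟩
      · exact .symm _ _ (.rel _ _ ⟨e, he, by simp⟩)
    | refl x => exact .refl _
    | symm x y _ ih => exact .symm _ _ ih
    | trans x y z _ _ h1 h2 => exact .trans _ _ _ h1 h2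

theorem faceJoined_iff (S : Set H.E) (u v : G.F) :
    G.FaceJoined (φ.onE ⁻¹' S) u v ↔ H.FaceJoined S (φ.onF u) (φ.onF v) := by
  constructor
  · intro h
    induction h with
    | rel x y h =>
      obtain ⟨e, he, rfl, rfl⟩ := h
      rcases φ.incidence e with h | h
      · exact .rel _ _ ⟨_, he, h.2.2⟩
      · exact .symm _ _ (.rel _ _ ⟨_, he, h.2.2⟩)
    | refl x => exact .refl _
    | symm x y _ ih => exact .symm _ _ ih
    | trans x y z _ _ h1 h2 => exact .trans _ _ _ h1 h2
  · suffices ∀ a b, H.FaceJoined S a b →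
        G.FaceJoined (φ.onE ⁻¹' S) (φ.onF.symm a) (φ.onF.symm b) by
      intro h
      simpa using this _ _ h
    intro a b h
    induction h with
    | rel x y h =>
      obtain ⟨e, he, rfl, rfl⟩ := h
      obtain ⟨e, rfl⟩ := φ.onE.surjective e
      rcases φ.incidence e with h | h <;> rw [h.2.2.1, h.2.2.2]
      · exact .rel _ _ ⟨e, he, by simp⟩
      · exact .symm _ _ (.rel _ _ ⟨e, he, by simp⟩)
    | refl x => exact .refl _
    | symm x y _ ih => exact .symm _ _ ih
    | trans x y z _ _ h1 h2 => exact .trans _ _ _ h1 h2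

theorem isSpanningTree_pull (T : Finset H.E) :
    G.IsSpanningTree (φ.pull T) ↔ H.IsSpanningTree T := by
  have h : ((φ.pull T : Finset G.E) : Set G.E) = φ.onE ⁻¹' (T : Set H.E) := by ext; simp
  simp only [IsSpanningTree, card_pull, Fintype.card_congr φ.onV, h, joined_iff]
  simp only [φ.onV.forall_congr_left, Equiv.apply_symm_apply]

theorem totalHeight_pull (T : Finset H.E) : G.totalHeight (φ.pull T) = H.totalHeight T := by
  unfold totalHeight
  rw [← card_pull φ, ← card_pull φ (Finset.univ.filter _)]
  congr 2 <;> ext e <;> simp [φ.high]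

theorem enclosed_cycle_iff (T : Finset H.E) (f : H.E) (x : G.F) :
    G.Enclosed (G.cycle (φ.pull T) (φ.onE.symm f)) x ↔
      H.Enclosed (H.cycle T f) (φ.onF x) := by
  have h : {g | g ∉ G.cycle (φ.pull T) (φ.onE.symm f)} =
      φ.onE ⁻¹' {g | g ∉ H.cycle T f} := by
    ext g
    have : (insert (φ.onE.symm f) (φ.pull T)).erase g =
        φ.pull ((insert f T).erase (φ.onE g)) := by
      ext e; simp [Equiv.eq_symm_apply]
    simp [cycle, this, isSpanningTree_pull, Equiv.eq_symm_apply]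
  rw [Enclosed, Enclosed, h, faceJoined_iff, φ.outer]

theorem joined_pull_erase_iff (T : Finset H.E) (e : H.E) (u v : G.V) :
    G.Joined {g | g ∈ φ.pull T ∧ g ≠ φ.onE.symm e} u v ↔
      H.Joined {g | g ∈ T ∧ g ≠ e} (φ.onV u) (φ.onV v) := by
  rw [← joined_iff]
  congr! 1
  ext; simp [Equiv.eq_symm_apply]

theorem counterclockwise_iff (base : G.V) (T : Finset H.E) (e f : H.E) :
    G.Counterclockwise base (φ.pull T) (φ.onE.symm e) (φ.onE.symm f) ↔
      H.Counterclockwise (φ.onV base) T e f := by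
  simp only [Counterclockwise, enclosed_cycle_iff, joined_pull_erase_iff]
  have := φ.incidence (φ.onE.symm f)
  rw [Equiv.apply_symm_apply] at this
  rcases this with ⟨h1, h2, h3, h4⟩ | ⟨h1, h2, h3, h4⟩ <;> rw [h1, h2, h3, h4]
  exact or_comm

end Iso
end PlaneGraph

/-! ### The linear algebra of the differential -/

/-- Two independent linear relations in three unknowns; the constants are solutions, hence the only
ones. -/
theorem eq_of_two_linear_relations {K : Type*} [Field K] {s p : Fin 3 → K}
    (hs : Function.Injective s)
    (h0 : (s 1 - s 2) * p 0 + (s 2 - s 0) * p 1 + (s 0 - s 1) * p 2 = 0)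
    (h1 : (s 1 - s 2) * s 0 * p 0 + (s 2 - s 0) * s 1 * p 1 + (s 0 - s 1) * s 2 * p 2 = 0)
    (a : Fin 3) : p a = p 0 := by
  have h01 : s 0 - s 1 ≠ 0 := sub_ne_zero.2 (hs.ne (by decide))
  have h02 : s 2 - s 0 ≠ 0 := sub_ne_zero.2 (hs.ne (by decide))
  have h12 : s 1 - s 2 ≠ 0 := sub_ne_zero.2 (hs.ne (by decide))
  have e1 : p 1 = p 0 :=
    mul_left_cancel₀ (mul_ne_zero h02 h12) (by linear_combination h1 - s 2 * h0)
  have e2 : p 2 = p 0 :=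
    mul_left_cancel₀ (mul_ne_zero h01 h12) (by linear_combination -h1 + s 1 * h0)
  fin_cases a
  · rfl
  · exact e1
  · exact e2

/-- The relations left after clearing denominators. Eliminating `q` and `q'` with the help of the
three values of `s` leaves a polynomial of degree `4` with the zeros `t b`, whose coefficients
therefore vanish. -/
theorem eq_const_of_quadratic_relations {K : Type*} [Field K] {h A B : K}
    {s : Fin 3 → K} {t : Fin 6 → K}
    (hh : h ≠ 0) (hA : A ≠ 0) (hA1 : 1 + A ≠ 0) (hB : B ≠ 0) (hB1 : 1 + B ≠ 0) (hAB : A ≠ B)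
    (hs : Function.Injective s) (hs0 : ∀ a, s a ≠ 0)
    (ht : Function.Injective t) (ht0 : ∀ b, t b ≠ 0) {p p' : Fin 3 → K} {q q' : Fin 6 → K}
    (H : ∀ a b, (1 + A) * p a + (1 + B) * q b + s a * t b * (p' a + q' b) +
      h * s a ^ 2 * t b ^ 2 * (A * p a + B * q b) = 0) :
    (∀ a, p a = 0) ∧ (∀ b, q b = 0) ∧ (∀ a, p' a = p' 0) ∧ (∀ b, q' b = - p' 0) := by
  have h01 : s 0 - s 1 ≠ 0 := sub_ne_zero.2 (hs.ne (by decide))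
  have h02 : s 2 - s 0 ≠ 0 := sub_ne_zero.2 (hs.ne (by decide))
  have h12 : s 1 - s 2 ≠ 0 := sub_ne_zero.2 (hs.ne (by decide))
  -- Lagrange interpolation at the nodes `s 0`, `s 1`, `s 2` expresses `(1 + B) * q b` and
  -- `h * B * t b ^ 2 * q b` through `p` and `p'`. The vector below lists the coefficients of the
  -- polynomial in `t b` that results from the proportionality of the two; five zeros suffice.
  have hcoef := Matrix.eq_zero_of_forall_index_sum_pow_mul_eq_zero
    (f := fun i : Fin 5 => t i.castSucc) (v := ![
      (1 + B) * (1 + A) * ((s 1 - s 2) * p 0 + (s 2 - s 0) * p 1 + (s 0 - s 1) * p 2),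
      (1 + B) * ((s 1 - s 2) * s 0 * p' 0 + (s 2 - s 0) * s 1 * p' 1 + (s 0 - s 1) * s 2 * p' 2),
      (1 + B) * h * A * ((s 1 - s 2) * s 0 ^ 2 * p 0 + (s 2 - s 0) * s 1 ^ 2 * p 1
        + (s 0 - s 1) * s 2 ^ 2 * p 2)
        - h * B * (1 + A) * ((s 1 - s 2) * s 1 * s 2 * p 0 + (s 2 - s 0) * s 0 * s 2 * p 1
        + (s 0 - s 1) * s 0 * s 1 * p 2),
      - (h * B * (s 0 * s 1 * s 2)) *
        ((s 1 - s 2) * p' 0 + (s 2 - s 0) * p' 1 + (s 0 - s 1) * p' 2),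
      - (h * B * h * A * (s 0 * s 1 * s 2)) *
        ((s 1 - s 2) * s 0 * p 0 + (s 2 - s 0) * s 1 * p 1 + (s 0 - s 1) * s 2 * p 2)])
    (ht.comp (Fin.castSucc_injective _)) (by
      intro j
      simp only [Fin.sum_univ_succ, Fin.sum_univ_zero]
      simp
      linear_combination
        ((1 + B) * (s 1 - s 2) - h * B * t j.castSucc ^ 2 * (s 1 - s 2) * s 1 * s 2)
          * H 0 j.castSucc
        + ((1 + B) * (s 2 - s 0) - h * B * t j.castSucc ^ 2 * (s 2 - s 0) * s 0 * s 2)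
          * H 1 j.castSucc
        + ((1 + B) * (s 0 - s 1) - h * B * t j.castSucc ^ 2 * (s 0 - s 1) * s 0 * s 1)
          * H 2 j.castSucc)
  have c0 := congrFun hcoef 0
  have c1 := congrFun hcoef 1
  have c2 := congrFun hcoef 2
  have c3 := congrFun hcoef 3
  have c4 := congrFun hcoef 4
  simp [hh, hA, hA1, hB, hB1, hs0] at c0 c1 c2 c3 c4
  have hp := eq_of_two_linear_relations hs c0 c4
  have hp' := eq_of_two_linear_relations hs c3 c1
  have hp0 : p 0 = 0 := by
    rw [hp 1, hp 2] at c2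
    have : h * (A - B) * ((s 0 - s 1) * (s 2 - s 0) * (s 1 - s 2)) * p 0 = 0 := by
      linear_combination -c2
    simpa [hh, sub_ne_zero.2 hAB, h01, h02, h12] using this
  have hp0' : ∀ a, p a = 0 := fun a => (hp a).trans hp0
  -- Now the relation for a fixed `b` is a quadratic polynomial with the three zeros `s a`.
  have hq : ∀ b, q b = 0 ∧ q' b = -p' 0 := by
    intro b
    have := Matrix.eq_zero_of_forall_index_sum_pow_mul_eq_zero (f := s)
      (v := ![(1 + B) * q b, t b * (p' 0 + q' b), h * t b ^ 2 * B * q b]) hs (by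
        intro a
        have := H a b
        rw [hp0', hp'] at this
        simp only [Fin.sum_univ_succ, Fin.sum_univ_zero]
        simp
        linear_combination this)
    have d0 := congrFun this 0
    have d1 := congrFun this 1
    simp [hB1, ht0] at d0 d1
    exact ⟨d0, by linear_combination d1⟩
  exact ⟨hp0', fun b => (hq b).1, hp', fun b => (hq b).2⟩

theorem one_div_one_add_inv {K : Type*} [Field K] (h2 : (2 : K) = 0) {z : K} (hz : z ≠ 0)
    (hz1 : 1 + z ≠ 0) : 1 / (1 + z⁻¹) = 1 + 1 / (1 + z) := by
  have : 1 + z⁻¹ = (1 + z) / z := by field_simp; ring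
  rw [this, one_div_div, ← sub_eq_zero]
  field_simp
  linear_combination -h2

/-- If all rows of the differential of the wheel vanish on `x`, then `x` is constant. Here `x i g`
is the value at the tree that contains the spoke `i` and omits the rim edge `g`, the weight of the
hub is `h`, the face variables are `w₀` and `w₁`, and `s a * t b` is the weight of a rim segment. -/
theorem eq_const_of_row_relations {K : Type*} [Field K] (h2 : (2 : K) = 0) {h w₀ w₁ : K}
    {s : Fin 3 → K} {t : Fin 6 → K}
    (hh : h ≠ 0) (hh1 : 1 + h ≠ 0) (hw₀ : w₀ ≠ 0) (hw₁ : w₁ ≠ 0)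
    (hw₀1 : 1 + w₀ ≠ 0) (hw₁1 : 1 + w₁ ≠ 0) (hw : 1 + w₀ * w₁ ≠ 0)
    (hs : Function.Injective s) (hs0 : ∀ a, s a ≠ 0)
    (ht : Function.Injective t) (ht0 : ∀ b, t b ≠ 0)
    (hst : ∀ a b, 1 + s a * t b ≠ 0) (hhst : ∀ a b, 1 + h * (s a * t b) ≠ 0)
    {x : Fin 2 → Fin 3 ⊕ Fin 6 → K}
    (H : ∀ a b,
      (1 / (1 + w₁) + 1 / (1 + h * (s a * t b))) * x 0 (.inl a) +
      (1 / (1 + w₁) + 1 / (1 + s a * t b)) * x 1 (.inl a) +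
      (1 / (1 + w₀) + 1 / (1 + (h * (s a * t b))⁻¹)) * x 0 (.inr b) +
      (1 / (1 + w₀) + 1 / (1 + (s a * t b)⁻¹)) * x 1 (.inr b) = 0) :
    ∀ i g, x i g = x 0 (.inl 0) := by
  have neg : ∀ z : K, -z = z := fun z => by linear_combination -z * h2
  obtain ⟨A, hA⟩ : ∃ A, A = 1 / (1 + w₁) := ⟨_, rfl⟩
  obtain ⟨B, hB⟩ : ∃ B, B = 1 / (1 + w₀⁻¹) := ⟨_, rfl⟩
  have hAw : A * (1 + w₁) = 1 := by rw [hA, one_div_mul_cancel hw₁1]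
  have hB' : 1 / (1 + w₀) = 1 + B := by
    rw [hB, one_div_one_add_inv h2 hw₀ hw₀1]
    linear_combination -h2
  have hBw : B * (1 + w₀) = w₀ := by
    linear_combination one_div_mul_cancel hw₀1 - (1 + w₀) * hB' - w₀ * h2
  -- The substitution that makes the relations polynomial: sums of the values at the two trees with
  -- the same missing rim edge, and combinations weighted by `h`; it is invertible as `h ≠ 1`.
  have key := eq_const_of_quadratic_relations (h := h) (A := A) (B := B) (s := s) (t := t)
    (p := fun a => x 0 (.inl a) + x 1 (.inl a))
    (q := fun b => x 0 (.inr b) + x 1 (.inr b))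
    (p' := fun a => x 0 (.inl a) + h * x 1 (.inl a) +
      (1 + h) * A * (x 0 (.inl a) + x 1 (.inl a)))
    (q' := fun b => x 0 (.inr b) + h * x 1 (.inr b) +
      (1 + h) * B * (x 0 (.inr b) + x 1 (.inr b)))
    hh (left_ne_zero_of_mul_eq_one hAw) ?_ ?_ ?_ ?_ hs hs0 ht ht0 ?_
  · obtain ⟨k1, k2, k3, k4⟩ := key
    simp only [k1, k2, mul_zero, add_zero, neg] at k3 k4
    have e1 : ∀ g, x 1 g = x 0 g := by
      rintro (a | b)
      · linear_combination k1 a - x 0 (.inl a) * h2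
      · linear_combination k2 b - x 0 (.inr b) * h2
    have e0 : ∀ g, x 0 g = x 0 (.inl 0) := by
      rintro (a | b) <;> apply mul_left_cancel₀ hh1
      · have := k3 a
        rw [e1, e1] at this
        linear_combination this
      · have := k4 b
        rw [e1, e1] at this
        linear_combination this
    intro i g
    fin_cases i
    · exact e0 g
    · exact (e1 g).trans (e0 g)
  · exact fun e => hw₁ (by linear_combination (1 + w₁) * e - hAw - h2)
  · exact left_ne_zero_of_mul (hBw.trans_ne hw₀)
  · exact fun e => one_ne_zero (α := K) (by
      linear_combination (1 + w₀) * e - hBw - w₀ * h2)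
  · exact fun e => hw (by
      linear_combination h2 + (1 + w₀) * hAw - (1 + w₀) * (1 + w₁) * e - (1 + w₁) * hBw)
  · intro a b
    have := H a b
    rw [hB', ← hA, one_div_one_add_inv h2 (mul_ne_zero (hs0 a) (ht0 b)) (hst a b),
      one_div_one_add_inv h2 (mul_ne_zero hh (mul_ne_zero (hs0 a) (ht0 b))) (hhst a b)] at this
    have k1 := one_div_mul_cancel (hst a b)
    have k2 := one_div_mul_cancel (hhst a b)
    linear_combination (1 + s a * t b) * (1 + h * (s a * t b)) * this
      - (1 + s a * t b) * (x 0 (.inl a) + x 0 (.inr b)) * k2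
      - (1 + h * (s a * t b)) * (x 1 (.inl a) + x 1 (.inr b)) * k1
      - (1 + s a * t b) * (1 + h * (s a * t b)) * (x 0 (.inr b) + x 1 (.inr b)) * h2

/-! ### A model of the wheel -/

namespace PlaneGraph

/-- The wheel with a hub `none`, nine rim vertices, two spokes that end at the rim vertices `0` and
`3`, and rim arcs of three and six edges. The rim edge `inl a` starts at the vertex `a`, the rim
edge `inr b` at the vertex `b + 3`. It is `wheelGraph ![3, 6]` with index types on which
propositions can be decided by evaluation. -/
abbrev wheel36 : PlaneGraph where
  V := Option (Fin 9)
  E := Fin 2 ⊕ (Fin 3 ⊕ Fin 6)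
  F := Option (Fin 2)
  src := Sum.elim (fun _ => none)
    (fun g => some (Sum.elim (Fin.castLE (by decide)) (Fin.natAdd 3) g))
  tgt := Sum.elim (fun s => some (![0, 3] s))
    (fun g => some (Sum.elim (Fin.castLE (by decide)) (Fin.natAdd 3) g + 1))
  left := Sum.elim some (fun g => some (Sum.elim (fun _ => 0) (fun _ => 1) g))
  right := Sum.elim (fun s => some (s - 1)) (fun _ => none)
  outer := none
  high := fun e => e.isLeft = true

/-- The two ways of numbering the edges. -/
def wheelEdges : (Fin 2 ⊕ (Σ i : Fin 2, Fin (![3, 6] i))) ≃ (Fin 2 ⊕ (Fin 3 ⊕ Fin 6)) where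
  toFun := Sum.map id fun a => match a with
    | ⟨0, a⟩ => Sum.inl a
    | ⟨1, b⟩ => Sum.inr b
  invFun := Sum.map id (Sum.elim (fun a => ⟨0, a⟩) (fun b => ⟨1, b⟩))
  left_inv := by rintro (s | ⟨i, a⟩) <;> [rfl; (fin_cases i <;> rfl)]
  right_inv := by rintro (s | a | b) <;> rfl

/-- The wheel graph is isomorphic to its model. -/
def wheelIso : (wheelGraph ![3, 6]).Iso wheel36 where
  onV := Equiv.optionCongr (finCongr (by decide))
  onE := wheelEdges
  onF := Equiv.refl _
  incidence := by
    intro e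
    left
    change Fin 2 ⊕ (Σ i : Fin 2, Fin (![3, 6] i)) at e
    revert e
    decide +kernel
  outer := rfl
  high e := by rcases e with _ | ⟨i, a⟩ <;> rfl

/-! ### Spanning trees and cycles of the wheel -/

/-- Membership in a cycle, free of the decidability instances in its definition. -/
theorem mem_cycle_iff (G : PlaneGraph) (T : Finset G.E) (f g : G.E) :
    g ∈ G.cycle T f ↔ (g = f ∨ g ∈ T) ∧
      ∃ T', (∀ e, e ∈ T' ↔ e ≠ g ∧ (e = f ∨ e ∈ T)) ∧ G.IsSpanningTree T' := by
  classical
  rw [cycle, Finset.mem_filter, Finset.mem_insert, and_congr_right_iff]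
  intro _
  constructor
  · exact fun h => ⟨_, fun e => by rw [Finset.mem_erase, Finset.mem_insert], h⟩
  · rintro ⟨T', h, hT⟩
    convert hT
    ext e
    rw [h, Finset.mem_erase, Finset.mem_insert]

namespace wheel36

/-- The arc to which a rim edge belongs; the sector with the same number is on its left. -/
def arc (g : Fin 3 ⊕ Fin 6) : Fin 2 := Sum.elim (fun _ => 0) (fun _ => 1) g

/-- The two rim segments that remain after removal of the rim edges `inl a` and `inr b`: the segment
`r` is the one that contains the end of the spoke `r`. The hub belongs to neither of them. -/
def Seg (r : Fin 2) (a : Fin 3) (b : Fin 6) : Option (Fin 9) → Prop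
  | none => False
  | some v => (a.1 < v.1 ∧ v.1 ≤ b.1 + 3) ↔ r = 1

instance (r a b) : DecidablePred (Seg r a b)
  | none => inferInstanceAs (Decidable False)
  | some v => inferInstanceAs (Decidable ((a.1 < v.1 ∧ v.1 ≤ b.1 + 3) ↔ r = 1))

/-- After removal of the spoke `s + 1` and of the rim edges `inl a` and `inr b`, one step from a
vertex towards the hub, or towards the end of the missing spoke if the vertex lies on that
segment. -/
def step (s : Fin 2) (a : Fin 3) (b : Fin 6) : Option (Fin 9) → Option (Fin 9)
  | none => none
  | some v =>
    if v = ![0, 3] s then none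
    else if v = ![0, 3] (s + 1) then some v
    else if v.1 ≤ a ∨ 3 < v.1 ∧ v.1 ≤ b.1 + 3 then some (v - 1)
    else some (v + 1)

theorem seg_src_iff_seg_tgt : ∀ (s : Fin 2) (a : Fin 3) (b : Fin 6) (e : wheel36.E),
    (Seg (s + 1) a b (wheel36.src e) ↔ Seg (s + 1) a b (wheel36.tgt e)) ↔
      e ≠ .inl (s + 1) ∧ e ≠ .inr (.inl a) ∧ e ≠ .inr (.inr b) := by
  decide +kernel

set_option synthInstance.maxSize 2000 in
theorem step_eq_or_exists_edge : ∀ (s : Fin 2) (a : Fin 3) (b : Fin 6) (v : Option (Fin 9)),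
    step s a b v = v ∨ ∃ e : Fin 2 ⊕ (Fin 3 ⊕ Fin 6),
      (e ≠ .inl (s + 1) ∧ e ≠ .inr (.inl a) ∧ e ≠ .inr (.inr b)) ∧
      (wheel36.src e = v ∧ wheel36.tgt e = step s a b v ∨
        wheel36.src e = step s a b v ∧ wheel36.tgt e = v) := by
  decide +kernel

/-- No vertex is more than six steps away from the hub or from the end of the missing spoke. -/
theorem iterate_step : ∀ (s : Fin 2) (a : Fin 3) (b : Fin 6) (v : wheel36.V),
    (step s a b)^[6] v = if Seg (s + 1) a b v then some (![0, 3] (s + 1)) else none := by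
  decide +kernel

/-- Removal of a spoke and of one rim edge from each arc leaves two components: the segment at the
end of the missing spoke, and the rest. -/
theorem joined_iff_seg {s : Fin 2} {a : Fin 3} {b : Fin 6} {S : Set wheel36.E}
    (hS : ∀ e, e ∈ S ↔ e ≠ .inl (s + 1) ∧ e ≠ .inr (.inl a) ∧ e ≠ .inr (.inr b))
    (u v : wheel36.V) :
    wheel36.Joined S u v ↔ (Seg (s + 1) a b u ↔ Seg (s + 1) a b v) := by
  constructor
  · intro h
    induction h with
    | rel x y h =>
      obtain ⟨e, he, rfl, rfl⟩ := h
      exact (seg_src_iff_seg_tgt s a b e).2 ((hS e).1 he)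
    | refl x => rfl
    | symm x y _ ih => exact ih.symm
    | trans x y z _ _ h1 h2 => exact h1.trans h2
  · have h1 : ∀ v, wheel36.Joined S v (step s a b v) := by
      intro v
      rcases step_eq_or_exists_edge s a b v with h | ⟨e, he, h | h⟩
      · rw [h]; exact .refl _
      · exact .rel _ _ ⟨e, (hS e).2 he, h⟩
      · exact .symm _ _ (.rel _ _ ⟨e, (hS e).2 he, h⟩)
    have h2 : ∀ (n : ℕ) v, wheel36.Joined S v ((step s a b)^[n] v) := by
      intro n
      induction n with
      | zero => exact fun v => .refl _
      | succ n ih => exact fun v => .trans _ _ _ (h1 v) (ih _)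
    intro h
    refine .trans _ _ _ (h2 6 u) (.symm _ _ ?_)
    have h3 := h2 6 v
    rwa [iterate_step, ← if_congr h rfl rfl, ← iterate_step] at h3

/-- Each of the three missing edges joins the two components. -/
theorem joined_of_extra_edge {s : Fin 2} {a : Fin 3} {b : Fin 6} {S : Set wheel36.E}
    (hS : ∀ e, e ≠ .inl (s + 1) ∧ e ≠ .inr (.inl a) ∧ e ≠ .inr (.inr b) → e ∈ S)
    {e : wheel36.E} (he : e ∈ S) (he' : e = .inl (s + 1) ∨ e = .inr (.inl a) ∨ e = .inr (.inr b))
    (u v : wheel36.V) : wheel36.Joined S u v := by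
  have h1 : ∀ u v, (Seg (s + 1) a b u ↔ Seg (s + 1) a b v) → wheel36.Joined S u v :=
    fun u v h => Relation.EqvGen.mono (fun x y ⟨e, h, h'⟩ => ⟨e, hS e h, h'⟩) _ _
      ((joined_iff_seg (S := {e | e ≠ .inl (s + 1) ∧ e ≠ .inr (.inl a) ∧ e ≠ .inr (.inr b)})
        (fun _ => Iff.rfl) u v).2 h)
  have h2 : wheel36.Joined S (wheel36.src e) (wheel36.tgt e) := .rel _ _ ⟨e, he, rfl, rfl⟩
  have h3 : ¬ (Seg (s + 1) a b (wheel36.src e) ↔ Seg (s + 1) a b (wheel36.tgt e)) := by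
    rw [seg_src_iff_seg_tgt]; tauto
  have h4 : ∀ u, wheel36.Joined S u (wheel36.src e) := by
    intro u
    by_cases h : Seg (s + 1) a b u ↔ Seg (s + 1) a b (wheel36.src e)
    · exact h1 _ _ h
    · exact .trans _ _ _ (h1 u _ (by tauto)) (.symm _ _ h2)
  exact .trans _ _ _ (h4 u) (.symm _ _ (h4 v))

/-- The spanning tree that contains the spoke `s` and omits the other spoke `s + 1` and the rim
edge `g`. -/
def oneSpoke (s : Fin 2) (g : Fin 3 ⊕ Fin 6) : Finset wheel36.E :=
  Finset.univ.filter fun e => e ≠ .inl (s + 1) ∧ e ≠ .inr g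

/-- The spanning tree that contains both spokes and omits one rim edge from each arc. -/
def twoSpokes (a : Fin 3) (b : Fin 6) : Finset wheel36.E :=
  Finset.univ.filter fun e => e ≠ .inr (.inl a) ∧ e ≠ .inr (.inr b)

@[simp]
theorem mem_oneSpoke {s : Fin 2} {g : Fin 3 ⊕ Fin 6} {e : wheel36.E} :
    e ∈ oneSpoke s g ↔ e ≠ .inl (s + 1) ∧ e ≠ .inr g := by simp [oneSpoke]

@[simp]
theorem mem_twoSpokes {a : Fin 3} {b : Fin 6} {e : wheel36.E} :
    e ∈ twoSpokes a b ↔ e ≠ .inr (.inl a) ∧ e ≠ .inr (.inr b) := by simp [twoSpokes]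

theorem not_isSpanningTree_of_cut {T : Finset wheel36.E} (P : wheel36.V → Prop)
    (h : ∀ e ∈ T, P (wheel36.src e) ↔ P (wheel36.tgt e)) (hP : ∃ u v, P u ∧ ¬ P v) :
    ¬ wheel36.IsSpanningTree T := by
  intro hT
  obtain ⟨u, v, hu, hv⟩ := hP
  have : ∀ u v, wheel36.Joined (T : Set wheel36.E) u v → (P u ↔ P v) := by
    intro u v h
    induction h with
    | rel x y h' =>
      obtain ⟨e, he, rfl, rfl⟩ := h'
      exact h e (by simpa using he)
    | refl x => rfl
    | symm x y _ ih => exact ih.symm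
    | trans x y z _ _ h1 h2 => exact h1.trans h2
  exact hv ((this u v (hT.1 u v)).1 hu)

/-- The rim vertices with numbers in the half-open interval `(p, q]`. -/
def Between (p q : ℕ) : Option (Fin 9) → Prop
  | none => False
  | some v => p < v.1 ∧ v.1 ≤ q

instance (p q : ℕ) : DecidablePred (Between p q)
  | none => inferInstanceAs (Decidable False)
  | some v => inferInstanceAs (Decidable (p < v.1 ∧ v.1 ≤ q))

theorem between_src_iff_inl : ∀ a a' : Fin 3, a < a' → ∀ e : wheel36.E,
    e ≠ .inr (.inl a) ∧ e ≠ .inr (.inl a') →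
      (Between a a' (wheel36.src e) ↔ Between a a' (wheel36.tgt e)) := by
  decide +kernel

theorem between_src_iff_inr : ∀ b b' : Fin 6, b < b' → ∀ e : wheel36.E,
    e ≠ .inr (.inr b) ∧ e ≠ .inr (.inr b') →
      (Between (b + 3) (b' + 3) (wheel36.src e) ↔ Between (b + 3) (b' + 3) (wheel36.tgt e)) := by
  decide +kernel

theorem not_isSpanningTree_of_inl {T : Finset wheel36.E} {a a' : Fin 3} (h : a < a')
    (hT : ∀ e ∈ T, e ≠ .inr (.inl a) ∧ e ≠ .inr (.inl a')) : ¬ wheel36.IsSpanningTree T :=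
  not_isSpanningTree_of_cut (Between a a')
    (fun e he => between_src_iff_inl a a' h e (hT e he))
    ⟨some (a'.castLE (by decide)), none, ⟨h, le_rfl⟩, id⟩

theorem not_isSpanningTree_of_inr {T : Finset wheel36.E} {b b' : Fin 6} (h : b < b')
    (hT : ∀ e ∈ T, e ≠ .inr (.inr b) ∧ e ≠ .inr (.inr b')) : ¬ wheel36.IsSpanningTree T :=
  not_isSpanningTree_of_cut (Between (b + 3) (b' + 3))
    (fun e he => between_src_iff_inr b b' h e (hT e he))
    ⟨some (b'.addNat 3), none, ⟨Nat.add_lt_add_right h 3, le_rfl⟩, id⟩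

theorem isSpanningTree_oneSpoke (s : Fin 2) (g : Fin 3 ⊕ Fin 6) :
    wheel36.IsSpanningTree (oneSpoke s g) := by
  refine ⟨fun u v => ?_, by revert s g; decide +kernel⟩
  rcases g with a | b
  · exact joined_of_extra_edge (s := s) (a := a) (b := 0) (e := .inr (.inr 0))
      (fun e he => mem_oneSpoke.2 ⟨he.1, he.2.1⟩) (mem_oneSpoke.2 (by simp)) (by simp) u v
  · exact joined_of_extra_edge (s := s) (a := 0) (b := b) (e := .inr (.inl 0))
      (fun e he => mem_oneSpoke.2 ⟨he.1, he.2.2⟩) (mem_oneSpoke.2 (by simp)) (by simp) u v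

theorem isSpanningTree_twoSpokes (a : Fin 3) (b : Fin 6) :
    wheel36.IsSpanningTree (twoSpokes a b) := by
  refine ⟨fun u v => ?_, by revert a b; decide +kernel⟩
  exact joined_of_extra_edge (s := 0) (a := a) (b := b) (e := .inl 1)
      (fun e he => mem_twoSpokes.2 he.2) (mem_twoSpokes.2 (by simp)) (by simp) u v

theorem isSpanningTree_iff (T : Finset wheel36.E) :
    wheel36.IsSpanningTree T ↔ (∃ s g, T = oneSpoke s g) ∨ ∃ a b, T = twoSpokes a b := by
  constructor
  · intro hT
    have hcard : Tᶜ.card = 2 := by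
      rw [Finset.card_compl]
      have h1 := hT.2
      have h2 : Fintype.card wheel36.V = 10 := rfl
      have h3 : Fintype.card wheel36.E = 11 := rfl
      omega
    obtain ⟨x, y, hxy, h⟩ := Finset.card_eq_two.1 hcard
    have hmem : ∀ e, e ∈ T ↔ e ≠ x ∧ e ≠ y := by
      intro e
      rw [← not_iff_not, ← Finset.mem_compl, h]
      simp [or_iff_not_imp_left]
    have hxT : x ∉ T := fun h => ((hmem x).1 h).1 rfl
    have hyT : y ∉ T := fun h => ((hmem y).1 h).2 rfl
    have hadd : ∀ s : Fin 2, s + 1 + 1 = s := by decide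
    rcases x with s | a | b <;> rcases y with s' | a' | b'
    · refine absurd hT (not_isSpanningTree_of_cut (· = none) (fun e he => ?_)
        ⟨none, some 0, rfl, nofun⟩)
      have he := (hmem e).1 he
      rcases e with t | g
      · simp only [ne_eq, Sum.inl.injEq] at hxy he
        omega
      · exact iff_of_false nofun nofun
    · exact .inl ⟨s + 1, .inl a', by ext e; rw [mem_oneSpoke, hmem, hadd]⟩
    · exact .inl ⟨s + 1, .inr b', by ext e; rw [mem_oneSpoke, hmem, hadd]⟩
    · exact .inl ⟨s' + 1, .inl a, by ext e; rw [mem_oneSpoke, hmem, hadd, and_comm]⟩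
    · rcases lt_or_gt_of_ne (show a ≠ a' by simpa using hxy) with h | h
      · exact absurd hT (not_isSpanningTree_of_inl h fun e he => (hmem e).1 he)
      · exact absurd hT (not_isSpanningTree_of_inl h fun e he => ((hmem e).1 he).symm)
    · exact .inr ⟨a, b', by ext e; rw [mem_twoSpokes, hmem]⟩
    · exact .inl ⟨s' + 1, .inr b, by ext e; rw [mem_oneSpoke, hmem, hadd, and_comm]⟩
    · exact .inr ⟨a', b, by ext e; rw [mem_twoSpokes, hmem, and_comm]⟩
    · rcases lt_or_gt_of_ne (show b ≠ b' by simpa using hxy) with h | h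
      · exact absurd hT (not_isSpanningTree_of_inr h fun e he => (hmem e).1 he)
      · exact absurd hT (not_isSpanningTree_of_inr h fun e he => ((hmem e).1 he).symm)
  · rintro (⟨s, g, rfl⟩ | ⟨a, b, rfl⟩)
    exacts [isSpanningTree_oneSpoke s g, isSpanningTree_twoSpokes a b]

theorem totalHeight_oneSpoke (s : Fin 2) (g : Fin 3 ⊕ Fin 6) :
    wheel36.totalHeight (oneSpoke s g) = 2 := by
  have h : ∀ s g, ((Finset.univ : Finset (Fin 2 ⊕ (Fin 3 ⊕ Fin 6))).filter
        fun e => e.isLeft = true ∧ e ∈ oneSpoke s g).card +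
      ((Finset.univ : Finset (Fin 2 ⊕ (Fin 3 ⊕ Fin 6))).filter
        fun e => ¬ e.isLeft = true ∧ e ∉ oneSpoke s g).card = 2 := by
    decide +kernel
  rw [← h s g]
  unfold totalHeight
  congr!

theorem totalHeight_twoSpokes (a : Fin 3) (b : Fin 6) :
    wheel36.totalHeight (twoSpokes a b) = 4 := by
  have h : ∀ a b, ((Finset.univ : Finset (Fin 2 ⊕ (Fin 3 ⊕ Fin 6))).filter
        fun e => e.isLeft = true ∧ e ∈ twoSpokes a b).card +
      ((Finset.univ : Finset (Fin 2 ⊕ (Fin 3 ⊕ Fin 6))).filter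
        fun e => ¬ e.isLeft = true ∧ e ∉ twoSpokes a b).card = 4 := by
    decide +kernel
  rw [← h a b]
  unfold totalHeight
  congr!

/-- The cycle consists of the two spokes and the arc that does not contain `g`. -/
theorem mem_cycle_oneSpoke (s : Fin 2) (g : Fin 3 ⊕ Fin 6) (x : wheel36.E) :
    x ∈ wheel36.cycle (oneSpoke s g) (.inl (s + 1)) ↔ ∀ g', x = .inr g' → arc g' = arc g + 1 := by
  have hadd : ∀ s : Fin 2, s + 1 + 1 = s := by decide
  have hne : ∀ s : Fin 2, s ≠ s + 1 := by decide
  have hins : ∀ e : wheel36.E, e = .inl (s + 1) ∨ e ∈ oneSpoke s g ↔ e ≠ .inr g := by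
    intro e
    rw [mem_oneSpoke]
    by_cases h : e = .inl (s + 1)
    · simp [h]
    · simp [h]
  rw [mem_cycle_iff, hins]
  constructor
  · rintro ⟨hx, T, her, hT⟩ g' rfl
    replace her := fun e => (her e).trans (and_congr_right' (hins e))
    rcases (isSpanningTree_iff _).1 hT with ⟨s', g'', rfl⟩ | ⟨a, b, rfl⟩
    · have := her (.inl (s' + 1))
      rw [mem_oneSpoke] at this
      simp at this
    · have h1 := her (.inr (.inl a))
      have h2 := her (.inr (.inr b))
      rw [mem_twoSpokes] at h1 h2
      rcases g with _ | _ <;> rcases g' with _ | _ <;> simp_all [arc]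
  · intro h
    refine ⟨fun hx => hne _ (h g hx), ?_⟩
    rcases x with s' | g'
    · exact ⟨_, fun e => by rw [hins, mem_oneSpoke, hadd], isSpanningTree_oneSpoke (s' + 1) g⟩
    · have := h g' rfl
      rcases g with a | b <;> rcases g' with a' | b'
      · simp [arc] at this
      · exact ⟨_, fun e => by rw [hins, mem_twoSpokes, and_comm], isSpanningTree_twoSpokes a b'⟩
      · exact ⟨_, fun e => by rw [hins, mem_twoSpokes], isSpanningTree_twoSpokes a' b⟩
      · simp [arc] at this

/-- The only enclosed face is the sector at the arc that does not contain `g`: the other sector is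
joined to the unbounded face across `g`. -/
theorem enclosed_cycle_oneSpoke (s : Fin 2) (g : Fin 3 ⊕ Fin 6) (x : wheel36.F) :
    wheel36.Enclosed (wheel36.cycle (oneSpoke s g) (.inl (s + 1))) x ↔ x = some (arc g + 1) := by
  have hadd : ∀ s : Fin 2, s ≠ s + 1 := by decide
  have hadd' : ∀ s t : Fin 2, s ≠ t + 1 → s = t := by decide
  rw [Enclosed, not_iff_comm]
  constructor
  · intro hx
    rcases x with _ | k
    · exact .refl _
    · have hk : k = arc g := hadd' _ _ (by simpa using hx)
      refine .rel _ _ ⟨.inr g, ?_, by rw [hk]; rfl, rfl⟩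
      rw [Set.mem_ofPred_eq, mem_cycle_oneSpoke]
      exact fun h => hadd _ (h g rfl)
  · rintro h rfl
    have : ∀ x y, wheel36.FaceJoined {e | e ∉ wheel36.cycle (oneSpoke s g) (.inl (s + 1))} x y →
        (x = some (arc g + 1) ↔ y = some (arc g + 1)) := by
      intro x y h
      induction h with
      | rel x y h =>
        obtain ⟨e, he, rfl, rfl⟩ := h
        rw [Set.mem_ofPred_eq, mem_cycle_oneSpoke] at he
        push Not at he
        obtain ⟨g', rfl, hg'⟩ := he
        exact iff_of_false (fun h => hg' (Option.some.inj h)) nofun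
      | refl x => rfl
      | symm x y _ ih => exact ih.symm
      | trans x y z _ _ h1 h2 => exact h1.trans h2
    exact absurd ((this _ _ h).1 rfl) nofun

theorem joined_oneSpoke_erase_iff {s : Fin 2} {g g' : Fin 3 ⊕ Fin 6} {a : Fin 3} {b : Fin 6}
    (h : g = .inl a ∧ g' = .inr b ∨ g = .inr b ∧ g' = .inl a) (u v : wheel36.V) :
    wheel36.Joined {x | x ∈ oneSpoke s g ∧ x ≠ .inr g'} u v ↔
      (Seg (s + 1) a b u ↔ Seg (s + 1) a b v) := by
  refine joined_iff_seg (fun e => ?_) u v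
  rw [Set.mem_ofPred_eq, mem_oneSpoke, and_assoc]
  rcases h with ⟨rfl, rfl⟩ | ⟨rfl, rfl⟩
  · rfl
  · rw [and_comm (a := e ≠ .inr (.inr b))]

theorem counterclockwise_oneSpoke_iff {s : Fin 2} {g g' : Fin 3 ⊕ Fin 6} {a : Fin 3} {b : Fin 6}
    (h : g = .inl a ∧ g' = .inr b ∨ g = .inr b ∧ g' = .inl a) (v : wheel36.V) :
    wheel36.Counterclockwise v (oneSpoke s g) (.inr g') (.inl (s + 1)) ↔
      (Seg (s + 1) a b v ↔ s = arc g) := by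
  have hroot : Seg (s + 1) a b (some (![0, 3] (s + 1))) := by
    clear h
    revert s a b; decide
  have h1 : wheel36.left (.inl (s + 1)) = some (s + 1) := rfl
  have h2 : wheel36.right (.inl (s + 1)) = some (s + 1 - 1) := rfl
  have h3 : wheel36.tgt (.inl (s + 1)) = some (![0, 3] (s + 1)) := rfl
  have h4 : wheel36.src (.inl (s + 1)) = none := rfl
  rw [Counterclockwise, enclosed_cycle_oneSpoke, enclosed_cycle_oneSpoke,
    joined_oneSpoke_erase_iff h, joined_oneSpoke_erase_iff h, h1, h2, h3, h4]
  have h5 : ∀ s k : Fin 2, s = k + 1 ↔ ¬ s = k := by decide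
  have h6 : ¬ Seg (s + 1) a b none := id
  simp only [hroot, h6, Option.some.injEq, add_left_inj, add_sub_cancel_right, true_iff,
    false_iff]
  rw [h5 s]
  tauto

/-- Which exchanges of a rim edge for a spoke lead from a tree with one spoke to a given tree with
two. -/
theorem edge_exchange_iff {s : Fin 2} {g : Fin 3 ⊕ Fin 6} {a : Fin 3} {b : Fin 6}
    (e f : wheel36.E) :
    (e ∈ oneSpoke s g ∧ f ∉ oneSpoke s g ∧ ¬ wheel36.high e ∧ wheel36.high f ∧
      ∀ x, x ∈ twoSpokes a b ↔ x = f ∨ x ≠ e ∧ x ∈ oneSpoke s g) ↔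
    f = .inl (s + 1) ∧ ∃ g', e = .inr g' ∧
      (g = .inl a ∧ g' = .inr b ∨ g = .inr b ∧ g' = .inl a) := by
  constructor
  · rintro ⟨he, hf, hel, hfl, h⟩
    rcases f with t | f
    · obtain rfl : t = s + 1 := by
        rw [mem_oneSpoke] at hf
        by_contra h
        exact hf ⟨fun h' => h (Sum.inl_injective h'), nofun⟩
      rcases e with t | g'
      · exact absurd rfl hel
      · refine ⟨rfl, g', rfl, ?_⟩
        have h1 := h (.inr (.inl a))
        have h2 := h (.inr (.inr b))
        rw [mem_twoSpokes, mem_oneSpoke] at h1 h2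
        rcases g with _ | _ <;> rcases g' with _ | _ <;> simp_all
    · exact absurd hfl Bool.noConfusion
  · rintro ⟨rfl, g', rfl, h⟩
    refine ⟨?_, ?_, Bool.noConfusion, rfl, fun x => ?_⟩
    · rw [mem_oneSpoke]
      rcases h with ⟨rfl, rfl⟩ | ⟨rfl, rfl⟩ <;> simp
    · rw [mem_oneSpoke]
      simp
    · rw [mem_twoSpokes, mem_oneSpoke]
      by_cases hx : x = .inl (s + 1)
      · simp [hx]
      · rcases h with ⟨rfl, rfl⟩ | ⟨rfl, rfl⟩ <;> simp [hx, and_comm]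

end wheel36
end PlaneGraph

/-! ### Genericity of the variables -/

namespace PlaneGraph

open scoped Classical

theorem two_eq_zero (G : PlaneGraph) (base : G.V) : (2 : G.FunField base) = 0 := by
  have h : (2 : ZMod 2) = 0 := rfl
  have := congrArg (algebraMap (MvPolynomial (G.Var base) (ZMod 2)) (G.FunField base))
    (congrArg (MvPolynomial.C (σ := G.Var base)) h)
  simpa only [map_ofNat, map_zero] using this

theorem one_add_ne_zero {G : PlaneGraph} {base : G.V} {z : G.FunField base} (hz : z ≠ 1) :
    1 + z ≠ 0 := fun h => hz (by linear_combination h - G.two_eq_zero base)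

/-- Otherwise a nonempty monomial would be `1`, but its value at the origin is `0`. -/
theorem prod_var_ne_one (G : PlaneGraph) (base : G.V) {Q : Finset (G.Var base)}
    (hQ : Q.Nonempty) : ∏ x ∈ Q, G.var base x ≠ 1 := by
  intro h
  have h1 : ∏ x ∈ Q, (MvPolynomial.X x : MvPolynomial (G.Var base) (ZMod 2)) = 1 := by
    apply IsFractionRing.injective (MvPolynomial (G.Var base) (ZMod 2)) (G.FunField base)
    rw [map_prod, map_one]
    exact h
  obtain ⟨x, hx⟩ := hQ
  have h2 := congrArg (MvPolynomial.eval 0) h1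
  rw [map_prod, Finset.prod_eq_zero hx (by simp), map_one] at h2
  exact zero_ne_one h2

theorem var_ne_zero (G : PlaneGraph) (base : G.V) (x : G.Var base) : G.var base x ≠ 0 := by
  intro h
  have := IsFractionRing.injective (MvPolynomial (G.Var base) (ZMod 2)) (G.FunField base)
    (h.trans (map_zero _).symm)
  exact MvPolynomial.X_ne_zero _ this

noncomputable section

/-- The variable of a vertex; the weight of the base point is chosen such that the product of the
weights of all vertices is `1`. -/
def weight (G : PlaneGraph) (base v : G.V) : G.FunField base :=
  if h : v = base then (∏ u : {u : G.V // u ≠ base}, G.var base (.inl u))⁻¹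
  else G.var base (.inl ⟨v, h⟩)

theorem weight_ne_zero (G : PlaneGraph) (base v : G.V) : G.weight base v ≠ 0 := by
  unfold weight
  split_ifs
  · exact inv_ne_zero (Finset.prod_ne_zero_iff.2 fun u _ => G.var_ne_zero base _)
  · exact G.var_ne_zero base _

theorem prod_weight_of_notMem (G : PlaneGraph) (base : G.V) {Q : Finset G.V} (hQ : base ∉ Q) :
    ∏ v ∈ Q, G.weight base v =
      ∏ u : {u : G.V // u ≠ base}, if u.1 ∈ Q then G.var base (.inl u) else 1 := by
  rw [← Fintype.prod_ite_mem, Fintype.prod_eq_mul_prod_subtype_ne _ base, if_neg hQ, one_mul]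
  refine Finset.prod_congr rfl fun u _ => ?_
  rw [weight, dif_neg u.2]

theorem prod_weight_univ (G : PlaneGraph) (base : G.V) : ∏ v, G.weight base v = 1 := by
  rw [Fintype.prod_eq_mul_prod_subtype_ne _ base]
  have : ∏ u : {u : G.V // u ≠ base}, G.weight base u =
      ∏ u : {u : G.V // u ≠ base}, G.var base (.inl u) :=
    Finset.prod_congr rfl fun u _ => by rw [weight, dif_neg u.2]
  rw [this, weight, dif_pos rfl, inv_mul_cancel₀]
  exact Finset.prod_ne_zero_iff.2 fun u _ => G.var_ne_zero base _

theorem prod_weight_compl (G : PlaneGraph) (base : G.V) (Q : Finset G.V) :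
    ∏ v ∈ Qᶜ, G.weight base v = (∏ v ∈ Q, G.weight base v)⁻¹ := by
  refine eq_inv_of_mul_eq_one_right ?_
  rw [Finset.prod_mul_prod_compl, prod_weight_univ]

/-- Passing to the complement inverts the product, so the base point may be assumed to be outside
`Q`. -/
theorem prod_weight_ne_one (G : PlaneGraph) (base : G.V) {Q : Finset G.V} (h0 : Q.Nonempty)
    (h1 : Qᶜ.Nonempty) : ∏ v ∈ Q, G.weight base v ≠ 1 := by
  have key : ∀ Q : Finset G.V, Q.Nonempty → base ∉ Q → ∏ v ∈ Q, G.weight base v ≠ 1 := by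
    rintro Q ⟨v, hv⟩ hb
    rw [prod_weight_of_notMem G base hb, ← Finset.prod_filter]
    have := G.prod_var_ne_one base
      (Q := (Finset.univ.filter fun u : {u : G.V // u ≠ base} => u.1 ∈ Q).map .inl)
      ⟨.inl ⟨v, fun h => hb (h ▸ hv)⟩, by simpa using hv⟩
    rwa [Finset.prod_map] at this
  by_cases hb : base ∈ Q
  · have := key Qᶜ h1 (by simpa using hb)
    rwa [prod_weight_compl, ne_eq, inv_eq_one] at this
  · exact key Q h0 hb

/-! ### The coefficients of the differential -/

variable {G : PlaneGraph} (φ : G.Iso wheel36) (base : G.V)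

/-- The weight of the vertex of `G` that corresponds to a vertex of the model. -/
def modelWeight (p : Option (Fin 9)) : G.FunField base := G.weight base (φ.onV.symm p)

/-- The face of `G` that corresponds to the sector `k`. -/
def boundedFace (k : Fin 2) : {x : G.F // x ≠ G.outer} :=
  ⟨φ.onF.symm (some k), by
    rw [ne_eq, Equiv.symm_apply_eq, ← φ.outer]
    exact nofun⟩

/-- The variable of the sector `k`. -/
def faceVar (k : Fin 2) : G.FunField base := G.var base (.inr (boundedFace φ k))

theorem prod_modelWeight (Q : Finset (Option (Fin 9))) :
    ∏ p ∈ Q, modelWeight φ base p = ∏ v ∈ Q.map φ.onV.symm.toEmbedding, G.weight base v := by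
  rw [Finset.prod_map]
  rfl

theorem prod_modelWeight_ne_one {Q : Finset (Option (Fin 9))} (h0 : Q.Nonempty)
    (h1 : ∃ p, p ∉ Q) : ∏ p ∈ Q, modelWeight φ base p ≠ 1 := by
  rw [prod_modelWeight]
  refine G.prod_weight_ne_one base (by simpa using h0) ?_
  obtain ⟨p, hp⟩ := h1
  exact ⟨φ.onV.symm p, by simpa using hp⟩

theorem prod_modelWeight_univ : ∏ p, modelWeight φ base p = 1 := by
  rw [← G.prod_weight_univ base]
  exact Equiv.prod_comp φ.onV.symm _

theorem modelWeight_ne_zero (p : Option (Fin 9)) : modelWeight φ base p ≠ 0 :=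
  G.weight_ne_zero base _

theorem faceVar_ne_zero (k : Fin 2) : faceVar φ base k ≠ 0 := G.var_ne_zero base _

theorem one_add_faceVar_ne_zero (k : Fin 2) : 1 + faceVar φ base k ≠ 0 := by
  apply one_add_ne_zero
  have := G.prod_var_ne_one base (Finset.singleton_nonempty
    (Sum.inr (boundedFace φ k)))
  rwa [Finset.prod_singleton] at this

theorem one_add_faceVar_mul_ne_zero : 1 + faceVar φ base 0 * faceVar φ base 1 ≠ 0 := by
  apply one_add_ne_zero
  have := G.prod_var_ne_one base (Finset.insert_nonempty
    (Sum.inr (boundedFace φ 0)) {(Sum.inr (boundedFace φ 1))})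
  rwa [Finset.prod_pair (by simp [boundedFace])] at this

/-- The product of the weights of the vertices in a rim segment. -/
def segWeight (r : Fin 2) (a : Fin 3) (b : Fin 6) : G.FunField base :=
  ∏ p with wheel36.Seg r a b p, modelWeight φ base p

theorem segWeight_ne_one (r : Fin 2) (a : Fin 3) (b : Fin 6) : segWeight φ base r a b ≠ 1 := by
  apply prod_modelWeight_ne_one
  · have : wheel36.Seg r a b (some (![0, 3] r)) := by revert r a b; decide
    exact ⟨_, by simpa using this⟩
  · exact ⟨none, fun h => (Finset.mem_filter.1 h).2⟩

theorem segWeight_ne_zero (r : Fin 2) (a : Fin 3) (b : Fin 6) : segWeight φ base r a b ≠ 0 :=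
  Finset.prod_ne_zero_iff.2 fun p _ => modelWeight_ne_zero φ base p

open wheel36

theorem alpha_pull_oneSpoke {s : Fin 2} {g g' : Fin 3 ⊕ Fin 6} {a : Fin 3} {b : Fin 6}
    (h : g = .inl a ∧ g' = .inr b ∨ g = .inr b ∧ g' = .inl a) :
    G.alpha base (φ.pull (oneSpoke s g)) (φ.onE.symm (.inr g')) (φ.onE.symm (.inl (s + 1))) =
      if Seg (s + 1) a b (φ.onV base) ↔ s = arc g then faceVar φ base (arc g + 1)
      else (faceVar φ base (arc g + 1))⁻¹ := by
  have key : ∀ z : {x : G.F // x ≠ G.outer} → G.FunField base,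
      (∏ x : {x : G.F // x ≠ G.outer}, if G.Enclosed
        (G.cycle (φ.pull (oneSpoke s g)) (φ.onE.symm (.inl (s + 1)))) x.1 then z x else 1) =
      z (boundedFace φ (arc g + 1)) := by
    intro z
    rw [Fintype.prod_eq_single (boundedFace φ (arc g + 1))]
    · rw [if_pos]
      rw [φ.enclosed_cycle_iff, enclosed_cycle_oneSpoke, boundedFace, Equiv.apply_symm_apply]
    · intro x hx
      rw [if_neg]
      rw [φ.enclosed_cycle_iff, enclosed_cycle_oneSpoke]
      exact fun h' => hx (Subtype.ext ((Equiv.symm_apply_eq _).2 h'.symm).symm)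
  rw [alpha, key, key (fun x => (G.var base (.inr x))⁻¹)]
  refine if_congr ?_ rfl rfl
  rw [φ.counterclockwise_iff, counterclockwise_oneSpoke_iff h]

theorem beta_pull_oneSpoke {s : Fin 2} {g g' : Fin 3 ⊕ Fin 6} {a : Fin 3} {b : Fin 6}
    (h : g = .inl a ∧ g' = .inr b ∨ g = .inr b ∧ g' = .inl a) :
    G.beta base (φ.pull (oneSpoke s g)) (φ.onE.symm (.inr g')) =
      if Seg (s + 1) a b (φ.onV base) then (segWeight φ base (s + 1) a b)⁻¹
      else segWeight φ base (s + 1) a b := by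
  simp only [beta, φ.joined_pull_erase_iff, joined_oneSpoke_erase_iff h]
  rw [segWeight, prod_modelWeight]
  split_ifs with hb
  · rw [← prod_weight_compl, prod_weight_of_notMem _ _ (by simpa using hb)]
    refine Finset.prod_congr rfl fun u _ => ?_
    simp only [hb, iff_true, Finset.mem_compl, Finset.mem_map_equiv, Equiv.symm_symm,
      Finset.mem_filter, Finset.mem_univ, true_and, ite_not]
  · rw [prod_weight_of_notMem _ _ (by simpa using hb)]
    refine Finset.prod_congr rfl fun u _ => ?_
    simp only [hb, iff_false, Finset.mem_map_equiv, Equiv.symm_symm,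
      Finset.mem_filter, Finset.mem_univ, true_and, ite_not]

/-- The position of the base point, which decides whether `alpha` and `beta` are inverted, drops
out. -/
theorem one_div_alpha_add_one_div_beta {s : Fin 2} {g g' : Fin 3 ⊕ Fin 6} {a : Fin 3} {b : Fin 6}
    (h : g = .inl a ∧ g' = .inr b ∨ g = .inr b ∧ g' = .inl a) :
    1 / (1 + G.alpha base (φ.pull (oneSpoke s g)) (φ.onE.symm (.inr g'))
        (φ.onE.symm (.inl (s + 1)))) +
      1 / (1 + G.beta base (φ.pull (oneSpoke s g)) (φ.onE.symm (.inr g'))) =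
    1 / (1 + faceVar φ base (arc g + 1)) +
      1 / (1 + if s = arc g then (segWeight φ base (s + 1) a b)⁻¹
        else segWeight φ base (s + 1) a b) := by
  have h2 := G.two_eq_zero base
  have e1 := one_div_one_add_inv h2 (faceVar_ne_zero φ base (arc g + 1))
    (one_add_faceVar_ne_zero φ base _)
  have e2 := one_div_one_add_inv h2 (segWeight_ne_zero φ base (s + 1) a b)
    (one_add_ne_zero (segWeight_ne_one φ base (s + 1) a b))
  rw [alpha_pull_oneSpoke φ base h, beta_pull_oneSpoke φ base h]
  by_cases hb : Seg (s + 1) a b (φ.onV base) <;> by_cases hs : s = arc g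
  · rw [if_pos (iff_of_true hb hs), if_pos hb, if_pos hs]
  · rw [if_neg fun h => hs (h.1 hb), if_pos hb, if_neg hs, e1, e2]
    linear_combination h2
  · rw [if_neg fun h => hb (h.2 hs), if_neg hb, if_pos hs, e1, e2]
    ring
  · rw [if_pos (iff_of_false hb hs), if_neg hb, if_neg hs]

theorem coeff_condition_iff {s : Fin 2} {g : Fin 3 ⊕ Fin 6} {a : Fin 3} {b : Fin 6}
    (e f : G.E) :
    (e ∈ φ.pull (oneSpoke s g) ∧ f ∉ φ.pull (oneSpoke s g) ∧ ¬ G.high e ∧ G.high f ∧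
      φ.pull (twoSpokes a b) = insert f ((φ.pull (oneSpoke s g)).erase e)) ↔
    f = φ.onE.symm (.inl (s + 1)) ∧ ∃ g', e = φ.onE.symm (.inr g') ∧
      (g = .inl a ∧ g' = .inr b ∨ g = .inr b ∧ g' = .inl a) := by
  simp only [Equiv.eq_symm_apply]
  rw [← edge_exchange_iff, φ.mem_pull, φ.mem_pull, φ.high, φ.high, Finset.ext_iff]
  simp only [Finset.mem_insert, Finset.mem_erase, φ.mem_pull]
  rw [φ.onE.forall_congr_left]
  simp only [Equiv.apply_symm_apply, ne_eq, Equiv.symm_apply_eq]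

theorem coeff_pull {s : Fin 2} {g g' : Fin 3 ⊕ Fin 6} {a : Fin 3} {b : Fin 6}
    (h : g = .inl a ∧ g' = .inr b ∨ g = .inr b ∧ g' = .inl a) :
    G.coeff base (φ.pull (oneSpoke s g)) (φ.pull (twoSpokes a b)) =
    1 / (1 + faceVar φ base (arc g + 1)) +
      1 / (1 + if s = arc g then (segWeight φ base (s + 1) a b)⁻¹
        else segWeight φ base (s + 1) a b) := by
  simp only [coeff, coeff_condition_iff]
  rw [← one_div_alpha_add_one_div_beta φ base h,
    Fintype.sum_eq_single (φ.onE.symm (.inr g')), Fintype.sum_eq_single (φ.onE.symm (.inl (s + 1))),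
    if_pos ⟨rfl, g', rfl, h⟩]
  · exact fun f hf => if_neg fun h' => hf h'.1
  · intro e he
    refine Finset.sum_eq_zero fun f _ => if_neg ?_
    rintro ⟨-, g'', rfl, h''⟩
    apply he
    rcases h with ⟨rfl, rfl⟩ | ⟨rfl, rfl⟩ <;> simp_all

theorem coeff_pull_eq_zero {s : Fin 2} {g : Fin 3 ⊕ Fin 6} {a : Fin 3} {b : Fin 6}
    (h : g ≠ .inl a) (h' : g ≠ .inr b) :
    G.coeff base (φ.pull (oneSpoke s g)) (φ.pull (twoSpokes a b)) = 0 := by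
  simp only [coeff, coeff_condition_iff]
  refine Finset.sum_eq_zero fun e _ => Finset.sum_eq_zero fun f _ => if_neg ?_
  rintro ⟨-, g', -, h1 | h1⟩
  exacts [h h1.1, h' h1.1]

theorem mul_segWeight_zero_mul_segWeight_one (a : Fin 3) (b : Fin 6) :
    modelWeight φ base none * segWeight φ base 0 a b * segWeight φ base 1 a b = 1 := by
  rw [← prod_modelWeight_univ φ base, Fintype.prod_option, mul_assoc]
  congr 1
  have hsome : ∀ r, segWeight φ base r a b =
      ∏ v : Fin 9 with ((a.1 < v.1 ∧ v.1 ≤ b.1 + 3) ↔ r = 1), modelWeight φ base (some v) := by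
    intro r
    rw [segWeight, Finset.prod_filter, Fintype.prod_option, if_neg (by exact id), one_mul,
      Finset.prod_filter]
    rfl
  rw [hsome, hsome, mul_comm]
  simp only [zero_ne_one, iff_false, iff_true]
  exact Finset.prod_filter_mul_prod_filter_not _ _ _

/-- The product of the weights of the rim vertices with numbers at most `a`. -/
def lowWeight (a : Fin 3) : G.FunField base :=
  ∏ v : Fin 9 with v.1 ≤ a.1, modelWeight φ base (some v)

/-- The product of the weights of the rim vertices with numbers greater than `b + 3`. -/
def topWeight (b : Fin 6) : G.FunField base :=
  ∏ v : Fin 9 with b.1 + 3 < v.1, modelWeight φ base (some v)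

theorem segWeight_zero (a : Fin 3) (b : Fin 6) :
    segWeight φ base 0 a b = lowWeight φ base a * topWeight φ base b := by
  rw [segWeight, Finset.prod_filter, Fintype.prod_option, if_neg (by exact id), one_mul,
    lowWeight, topWeight, ← Finset.prod_filter, ← Finset.prod_union]
  · refine Finset.prod_congr ?_ fun _ _ => rfl
    ext v
    simp only [Seg, Finset.mem_filter, Finset.mem_univ, true_and, Finset.mem_union, zero_ne_one,
      iff_false]
    omega
  · rw [Finset.disjoint_filter]
    intro v _ h
    omega

theorem segWeight_one (a : Fin 3) (b : Fin 6) :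
    segWeight φ base 1 a b =
      (modelWeight φ base none * (lowWeight φ base a * topWeight φ base b))⁻¹ := by
  rw [← segWeight_zero]
  exact eq_inv_of_mul_eq_one_right (mul_segWeight_zero_mul_segWeight_one φ base a b)

theorem prod_rim_ne_of_ssubset {A B : Finset (Fin 9)} (h : A ⊂ B) :
    ∏ v ∈ A, modelWeight φ base (some v) ≠ ∏ v ∈ B, modelWeight φ base (some v) := by
  rw [← Finset.prod_sdiff h.subset]
  intro he
  have := prod_modelWeight_ne_one φ base (Q := (B \ A).map Function.Embedding.some)
    ((Finset.sdiff_nonempty.2 h.not_subset).map) ⟨none, by simp⟩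
  rw [Finset.prod_map] at this
  have hA : ∏ v ∈ A, modelWeight φ base (some v) ≠ 0 :=
    Finset.prod_ne_zero_iff.2 fun v _ => modelWeight_ne_zero φ base (some v)
  exact this (mul_right_cancel₀ hA (he.symm.trans (one_mul _).symm))

theorem lowWeight_injective : Function.Injective (lowWeight φ base) := by
  refine Function.Injective.of_lt_imp_ne fun a a' h => prod_rim_ne_of_ssubset φ base ?_
  refine Finset.ssubset_iff_of_subset (fun v => ?_) |>.2 ⟨a'.castLE (by decide), ?_⟩ <;>
    simp only [Finset.mem_filter, Finset.mem_univ, true_and, Fin.val_castLE] <;> omega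

theorem topWeight_injective : Function.Injective (topWeight φ base) := by
  refine Function.Injective.of_lt_imp_ne fun b b' h => (prod_rim_ne_of_ssubset φ base ?_).symm
  refine Finset.ssubset_iff_of_subset (fun v => ?_) |>.2 ⟨b'.addNat 3, ?_⟩ <;>
    simp only [Finset.mem_filter, Finset.mem_univ, true_and, Fin.val_addNat] <;> omega

/-- A cochain in degree `1` is closed if and only if it is constant. -/
theorem forall_sum_coeff_mul_eq_zero_iff (x : Fin 2 → Fin 3 ⊕ Fin 6 → G.FunField base) :
    (∀ a b, ∑ s, ∑ g,
      G.coeff base (φ.pull (oneSpoke s g)) (φ.pull (twoSpokes a b)) * x s g = 0) ↔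
    ∀ s g, x s g = x 0 (.inl 0) := by
  have hne : modelWeight φ base none ≠ 0 := modelWeight_ne_zero φ base none
  have hrow : ∀ a b, ∑ s, ∑ g,
      G.coeff base (φ.pull (oneSpoke s g)) (φ.pull (twoSpokes a b)) * x s g =
      (1 / (1 + faceVar φ base 1) + 1 / (1 + modelWeight φ base none *
        (lowWeight φ base a * topWeight φ base b))) * x 0 (.inl a) +
      (1 / (1 + faceVar φ base 1) + 1 / (1 + lowWeight φ base a * topWeight φ base b))
        * x 1 (.inl a) +
      (1 / (1 + faceVar φ base 0) + 1 / (1 + (modelWeight φ base none *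
        (lowWeight φ base a * topWeight φ base b))⁻¹)) * x 0 (.inr b) +
      (1 / (1 + faceVar φ base 0) + 1 / (1 + (lowWeight φ base a * topWeight φ base b)⁻¹))
        * x 1 (.inr b) := by
    intro a b
    have hsum : ∀ s, ∑ g,
        G.coeff base (φ.pull (oneSpoke s g)) (φ.pull (twoSpokes a b)) * x s g =
        G.coeff base (φ.pull (oneSpoke s (.inl a))) (φ.pull (twoSpokes a b)) * x s (.inl a) +
        G.coeff base (φ.pull (oneSpoke s (.inr b))) (φ.pull (twoSpokes a b)) * x s (.inr b) := by
      intro s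
      refine Fintype.sum_eq_add _ _ (by simp) fun g hg => ?_
      rw [coeff_pull_eq_zero φ base hg.1 hg.2, zero_mul]
    rw [Fin.sum_univ_two, hsum, hsum]
    simp only [coeff_pull φ base (.inl ⟨rfl, rfl⟩ : (Sum.inl a : Fin 3 ⊕ Fin 6) = .inl a ∧
        (Sum.inr b : Fin 3 ⊕ Fin 6) = .inr b ∨ _),
      coeff_pull φ base (.inr ⟨rfl, rfl⟩ : _ ∨ (Sum.inr b : Fin 3 ⊕ Fin 6) = .inr b ∧
        (Sum.inl a : Fin 3 ⊕ Fin 6) = .inl a)]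
    have h11 : (1 : Fin 2) + 1 = 0 := rfl
    simp only [arc, Sum.elim_inl, Sum.elim_inr, zero_add, h11, if_true, zero_ne_one, one_ne_zero,
      if_false, segWeight_one, segWeight_zero, inv_inv]
    ring
  have hlow : ∀ a, lowWeight φ base a ≠ 0 := fun a =>
    Finset.prod_ne_zero_iff.2 fun p _ => modelWeight_ne_zero φ base _
  have htop : ∀ b, topWeight φ base b ≠ 0 := fun b =>
    Finset.prod_ne_zero_iff.2 fun p _ => modelWeight_ne_zero φ base _
  have h0 : ∀ a b, 1 + lowWeight φ base a * topWeight φ base b ≠ 0 := by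
    intro a b
    rw [← segWeight_zero]
    exact one_add_ne_zero (segWeight_ne_one φ base 0 a b)
  have h1 : ∀ a b,
      1 + modelWeight φ base none * (lowWeight φ base a * topWeight φ base b) ≠ 0 := by
    intro a b
    apply one_add_ne_zero
    have := segWeight_ne_one φ base 1 a b
    rwa [segWeight_one, ne_eq, inv_eq_one] at this
  simp only [hrow]
  constructor
  · refine eq_const_of_row_relations (G.two_eq_zero base) hne ?_ (faceVar_ne_zero φ base 0)
      (faceVar_ne_zero φ base 1) (one_add_faceVar_ne_zero φ base 0)
      (one_add_faceVar_ne_zero φ base 1) (one_add_faceVar_mul_ne_zero φ base)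
      (lowWeight_injective φ base) hlow (topWeight_injective φ base) htop h0 h1
    apply one_add_ne_zero
    have := prod_modelWeight_ne_one φ base (Finset.singleton_nonempty none) ⟨some 0, by simp⟩
    rwa [Finset.prod_singleton] at this
  · intro h a b
    rw [h 1 (.inl a), h 0 (.inl a), h 0 (.inr b), h 1 (.inr b),
      one_div_one_add_inv (G.two_eq_zero base) (mul_ne_zero (hlow a) (htop b)) (h0 a b),
      one_div_one_add_inv (G.two_eq_zero base)
        (mul_ne_zero hne (mul_ne_zero (hlow a) (htop b))) (h1 a b)]
    linear_combination x 0 (.inl 0) * (1 + 1 / (1 + faceVar φ base 0) +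
      1 / (1 + faceVar φ base 1) + 1 / (1 + lowWeight φ base a * topWeight φ base b) +
      1 / (1 + modelWeight φ base none * (lowWeight φ base a * topWeight φ base b))) *
      G.two_eq_zero base

end

end PlaneGraph

/-! ### Dimensions -/

namespace PlaneGraph

open scoped Classical

namespace wheel36

theorem oneSpoke_injective : Function.Injective
    (fun p : Fin 2 × (Fin 3 ⊕ Fin 6) => oneSpoke p.1 p.2) := by
  rintro ⟨s, g⟩ ⟨s', g'⟩ h
  have h1 := mem_oneSpoke.symm.trans
    ((Finset.ext_iff.1 h (.inl (s + 1))).trans mem_oneSpoke)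
  have h2 := mem_oneSpoke.symm.trans
    ((Finset.ext_iff.1 h (.inr g)).trans mem_oneSpoke)
  simp_all

theorem twoSpokes_injective : Function.Injective
    (fun p : Fin 3 × Fin 6 => twoSpokes p.1 p.2) := by
  rintro ⟨a, b⟩ ⟨a', b'⟩ h
  have h1 := mem_twoSpokes.symm.trans
    ((Finset.ext_iff.1 h (.inr (.inl a))).trans mem_twoSpokes)
  have h2 := mem_twoSpokes.symm.trans
    ((Finset.ext_iff.1 h (.inr (.inr b))).trans mem_twoSpokes)
  simp_all

end wheel36

noncomputable section

variable {G : PlaneGraph} (φ : G.Iso wheel36)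

open wheel36

theorem isSpanningTree_iff_pull (T : Finset G.E) :
    G.IsSpanningTree T ↔
      (∃ s g, T = φ.pull (oneSpoke s g)) ∨ ∃ a b, T = φ.pull (twoSpokes a b) := by
  obtain ⟨T, rfl⟩ := φ.pull_surjective T
  simp only [φ.isSpanningTree_pull, isSpanningTree_iff, φ.pull_injective.eq_iff]

theorem isEmpty_tree (φ : G.Iso wheel36) {i : ℚ} (h1 : i ≠ 1) (h2 : i ≠ 2) :
    IsEmpty (G.Tree i) := by
  constructor
  rintro ⟨T, hT, hi⟩
  rcases (isSpanningTree_iff_pull φ T).1 hT with ⟨s, g, rfl⟩ | ⟨a, b, rfl⟩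
  · rw [φ.totalHeight_pull, totalHeight_oneSpoke] at hi
    push_cast at hi
    exact h1 (by linarith)
  · rw [φ.totalHeight_pull, totalHeight_twoSpokes] at hi
    push_cast at hi
    exact h2 (by linarith)

/-- The generators in degree `1` are the trees with one spoke. -/
def oneSpokeEquiv {i : ℚ} (hi : i = 1) : Fin 2 × (Fin 3 ⊕ Fin 6) ≃ G.Tree i :=
  Equiv.ofBijective (fun p => ⟨φ.pull (oneSpoke p.1 p.2),
    (φ.isSpanningTree_pull _).2 (isSpanningTree_oneSpoke _ _), by
      rw [φ.totalHeight_pull, totalHeight_oneSpoke, hi]; norm_num⟩) <| by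
    constructor
    · intro p q h
      exact oneSpoke_injective (φ.pull_injective (congrArg Subtype.val h))
    · rintro ⟨T, hT, h⟩
      rcases (isSpanningTree_iff_pull φ T).1 hT with ⟨s, g, rfl⟩ | ⟨a, b, rfl⟩
      · exact ⟨(s, g), rfl⟩
      · rw [φ.totalHeight_pull, totalHeight_twoSpokes, hi] at h
        norm_num at h

/-- The generators in degree `2` are the trees with two spokes. -/
def twoSpokesEquiv {i : ℚ} (hi : i = 2) : Fin 3 × Fin 6 ≃ G.Tree i :=
  Equiv.ofBijective (fun p => ⟨φ.pull (twoSpokes p.1 p.2),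
    (φ.isSpanningTree_pull _).2 (isSpanningTree_twoSpokes _ _), by
      rw [φ.totalHeight_pull, totalHeight_twoSpokes, hi]; norm_num⟩) <| by
    constructor
    · intro p q h
      exact twoSpokes_injective (φ.pull_injective (congrArg Subtype.val h))
    · rintro ⟨T, hT, h⟩
      rcases (isSpanningTree_iff_pull φ T).1 hT with ⟨s, g, rfl⟩ | ⟨a, b, rfl⟩
      · rw [φ.totalHeight_pull, totalHeight_oneSpoke, hi] at h
        norm_num at h
      · exact ⟨(a, b), rfl⟩

theorem ker_differential (φ : G.Iso wheel36) (base : G.V) {i j : ℚ} (hi : i = 1) (hj : j = 2) :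
    LinearMap.ker (G.differential base i j) = Submodule.span (G.FunField base) {fun _ => 1} := by
  ext x
  have hrow : ∀ T, G.differential base i j x T = ∑ s, ∑ g,
      G.coeff base (φ.pull (oneSpoke s g)) T.1 * x (oneSpokeEquiv φ hi (s, g)) := by
    intro T
    rw [← Fintype.sum_prod_type', differential, Matrix.mulVecLin_apply]
    exact ((oneSpokeEquiv φ hi).sum_comp fun T' => G.coeff base T'.1 T.1 * x T').symm
  have hker : G.differential base i j x = 0 ↔ ∀ a b, ∑ s, ∑ g,
      G.coeff base (φ.pull (oneSpoke s g)) (φ.pull (twoSpokes a b)) *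
        x (oneSpokeEquiv φ hi (s, g)) = 0 := by
    rw [funext_iff, (twoSpokesEquiv φ hj).surjective.forall, Prod.forall]
    simp only [hrow]
    rfl
  rw [LinearMap.mem_ker, hker, forall_sum_coeff_mul_eq_zero_iff φ base
    fun s g => x (oneSpokeEquiv φ hi (s, g)), Submodule.mem_span_singleton]
  constructor
  · intro h
    refine ⟨x (oneSpokeEquiv φ hi (0, .inl 0)), funext fun T => ?_⟩
    obtain ⟨⟨s, g⟩, rfl⟩ := (oneSpokeEquiv φ hi).surjective T
    rw [h s g]
    exact mul_one _
  · rintro ⟨c, rfl⟩ s g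
    rfl

theorem finrank_cohomology_add (base : G.V) (i : ℚ)
    (h : LinearMap.range (G.differential base (i - 1) i) ≤
      LinearMap.ker (G.differential base i (i + 1))) :
    Module.finrank (G.FunField base) (G.Cohomology base i) +
      Module.finrank (G.FunField base) (LinearMap.range (G.differential base (i - 1) i)) =
    Module.finrank (G.FunField base) (LinearMap.ker (G.differential base i (i + 1))) := by
  rw [← Submodule.finrank_quotient_add_finrank
    ((LinearMap.range (G.differential base (i - 1) i)).submoduleOf
      (LinearMap.ker (G.differential base i (i + 1)))),
    (Submodule.submoduleOfEquivOfLe h).finrank_eq]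

theorem finrank_ker_differential (φ : G.Iso wheel36) (base : G.V) {i j : ℚ}
    (hi : i = 1) (hj : j = 2) :
    Module.finrank (G.FunField base) (LinearMap.ker (G.differential base i j)) = 1 := by
  rw [ker_differential φ base hi hj]
  refine finrank_span_singleton fun h => ?_
  exact one_ne_zero (congrFun h (oneSpokeEquiv φ hi (0, .inl 0)))

theorem finrank_range_differential (φ : G.Iso wheel36) (base : G.V) {i j : ℚ}
    (hi : i = 1) (hj : j = 2) :
    Module.finrank (G.FunField base) (LinearMap.range (G.differential base i j)) = 17 := by
  have h := (G.differential base i j).finrank_range_add_finrank_ker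
  rw [finrank_ker_differential φ base hi hj, Module.finrank_fintype_fun_eq_card,
    ← Fintype.card_congr (oneSpokeEquiv φ hi)] at h
  simpa using h

theorem finrank_cohomology_wheel36 (φ : G.Iso wheel36) (base : G.V) (i : ℚ) :
    Module.finrank (G.FunField base) (G.Cohomology base i) = if i = 1 ∨ i = 2 then 1 else 0 := by
  by_cases h1 : i = 1
  · have : IsEmpty (G.Tree (i - 1)) := isEmpty_tree φ (by rw [h1]; norm_num) (by rw [h1]; norm_num)
    have hr : LinearMap.range (G.differential base (i - 1) i) = ⊥ :=
      LinearMap.range_eq_bot.2 (Subsingleton.elim _ _)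
    have hr0 := congrArg (fun M : Submodule _ _ => Module.finrank (G.FunField base) M) hr
    have h := finrank_cohomology_add base i (hr.trans_le bot_le)
    rw [hr0, finrank_bot, add_zero,
      finrank_ker_differential φ base h1 (by rw [h1]; norm_num)] at h
    rw [h, if_pos (.inl h1)]
  by_cases h2 : i = 2
  · have : IsEmpty (G.Tree (i + 1)) := isEmpty_tree φ (by rw [h2]; norm_num) (by rw [h2]; norm_num)
    have hk : LinearMap.ker (G.differential base i (i + 1)) = ⊤ :=
      LinearMap.ker_eq_top.2 (Subsingleton.elim _ _)
    have hk0 := congrArg (fun M : Submodule _ _ => Module.finrank (G.FunField base) M) hk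
    have h := finrank_cohomology_add base i (le_top.trans_eq hk.symm)
    rw [hk0, finrank_top, finrank_range_differential φ base (by rw [h2]; norm_num) h2,
      Module.finrank_fintype_fun_eq_card, ← Fintype.card_congr (twoSpokesEquiv φ h2)] at h
    rw [if_pos (.inr h2)]
    simpa using h
  · have : IsEmpty (G.Tree i) := isEmpty_tree φ h1 h2
    rw [if_neg (by tauto)]
    exact Module.finrank_zero_of_subsingleton

end
end PlaneGraph

theorem corollary4p2 (D : LinkProjection) (S : D.Colouring)
    (hD : Nonempty (S.blackGraph.Iso (wheelGraph ![3, 6])))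
    (base : S.blackGraph.V) (i : ℚ) :
    Module.finrank (S.blackGraph.FunField base) (S.blackGraph.Cohomology base i) =
      if i = 1 ∨ i = 2 then 1 else 0 := by
  obtain ⟨φ⟩ := hD
  exact PlaneGraph.finrank_cohomology_wheel36 (φ.trans PlaneGraph.wheelIso) base i
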